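/- **Setting.** Rings are associative with $1$, modules are right modules, $\mathbb N$ contains $0$. A ring $A\supseteq R$ is a *skew PBW extension* of $R$ if there are $x_1,\dots,x_n\in A$ such that $A$ is a free left $R$-module on the monomials $x^\alpha=x_1^{\alpha_1}\cdots x_n^{\alpha_n}$ ($\alpha\in\mathbb N^n$); for all $i$ and $0\ne r\in R$ there is $0\ne c\in R$ with $x_ir-cx_i\in R$; and for all $i,j$ there is $0\neq d_{i,j}\in R$ with $x_jx_i-d_{i,j}x_ix_j\in R+Rx_1+\cdots+Rx_n$. Then $x_ir=\sigma_i(r)x_i+\delta_i(r)$ for uniquely determined maps $\sigma_i,\delta_i:R\to R$ (an injective endomorphism and a $\sigma_i$-derivation). $A$ is *bijective* if all $\sigma_i$ are bijective and $d_{i,j}$ is invertible for $i<j$. $A$ is *quantized* if there are central invertible $q_1,\dots,q_n\in R$ with $\delta_i\sigma_i=q_i\sigma_i\delta_i$, $\sigma_i(q_j)=q_j$ and $\delta_i(q_j)=0$ for all $1\le i,j\le n$. Put $\sigma^\alpha=\sigma_1^{\alpha_1}\circ\cdots\circ\sigma_n^{\alpha_n}$ and $\delta^\beta=\delta_1^{\beta_1}\circ\cdots\circ\delta_n^{\beta_n}$.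 A subset $I\subseteq R$ is $(\Sigma,\Sigma^{-1})$-*stable* if $\sigma_i(I)=I$ for all $i$, and $(\Sigma,\Sigma^{-1},\Delta)$-*stable* if moreover $\delta_i(I)\subseteq I$ for all $i$. Put $$I_\Delta=\{a\in I:\delta^\beta(a)\in I\ \forall\beta\},\qquad I_{\Sigma,\Delta}=\{a\in I:\sigma^\alpha\delta^\beta(a)\in I\ \forall\alpha,\beta\},$$ and let $I\langle X\rangle$ be the set of all $f=\sum_\alpha r_\alpha x^\alpha\in A$ with all $r_\alpha\in I$. A module $N$ is *prime* if $N\neq0$ and $\operatorname{ann}(N')=\operatorname{ann}(N)$ for every nonzero submodule $N'\subseteq N$; $\operatorname{Ass}(M_R)$ is the set of prime ideals of $R$ of the form $\operatorname{ann}_R(N)$ with $N$ a prime submodule of $M_R$ (and likewise over $A$). $M_R$ has *enough prime submodules* if every nonzero submodule of $M$ contains a prime submodule. $M\langle X\rangle_A=M\otimes_RA$ is the induced module; its elements are written uniquely as $\sum_\alpha m_\alpha x^\alpha$ with $m_\alpha\in M$. Fix a degree-compatible monomial order on the monomials, that is, a total order $\preceq$ on $\mathbb N^n$ which is compatible with addition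 and satisfies $\alpha\prec\beta$ whenever $|\alpha|<|\beta|$, and let $\operatorname{lm}(m)$ be the resulting leading monomial of $0\ne m\in M\langle X\rangle$. Such an $m$ is a *good polynomial* if $\operatorname{lm}(mr)=\operatorname{lm}(m)$ for every $r\in R$ with $mr\ne0$. $M\langle X\rangle_A$ is *good* if for every good polynomial $m$, with $\operatorname{lm}(m)=x^\alpha$, and every $\beta\in\mathbb N^n$ with $\beta_i\ge\alpha_i$ for all $i$, there is a good polynomial $f\in mA$ with $\operatorname{lm}(f)=x^\beta$. **Theorem.** Let $A$ be a bijective skew PBW extension of $R$, let $M_R$ be a right module with enough prime submodules, and let $Q\in\operatorname{Ass}(M\langle X\rangle_A)$. 1. If every $P\in\operatorname{Ass}(M_R)$ is $(\Sigma,\Sigma^{-1},\Delta)$-stable, then $Q=P\langle X\rangle$ for some $P\in\operatorname{Ass}(M_R)$. 2. If $A$ is quantized and every $P\in\operatorname{Ass}(M_R)$ is $(\Sigma,\Sigma^{-1})$-stable, then $Q=P_\Delta\langle X\rangle$ for some $P\in\operatorname{Ass}(M_R)$. 3. If $A$ is quantized and $M\langle X\rangle_A$ is good, then there is $P\in\operatorname{Ass}(M_R)$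 such that $Q=P_{\Sigma,\Delta}\langle X\rangle$ and $P_{\Sigma,\Delta}$ is $(\Sigma,\Sigma^{-1})$-stable. -/

import Mathlib

open MulOpposite

noncomputable section

/-! Right `R`-modules are modules over the opposite ring `Rᵐᵒᵖ`; the product `m r` is `op r • m`. -/

namespace RightModule

/-- The right annihilator `{r ∈ R | N r = 0}` of a submodule `N` of a right `R`-module,
a two-sided ideal of `R`. -/
def annihilator {R M : Type*} [Ring R] [AddCommGroup M] [Module Rᵐᵒᵖ M]
    (N : Submodule Rᵐᵒᵖ M) : TwoSidedIdeal R :=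
  TwoSidedIdeal.mk' {r : R | ∀ v ∈ N, op r • v = 0}
    (by intro v _; simp)
    (by intro r s hr hs v hv; simp [add_smul, hr v hv, hs v hv])
    (by intro r hr v hv; simp [neg_smul, hr v hv])
    (by
      intro r s hs v hv
      rw [op_mul, mul_smul]
      exact hs _ (N.smul_mem _ hv))
    (by
      intro r s hr v hv
      rw [op_mul, mul_smul, hr v hv, smul_zero])

theorem mem_annihilator {R M : Type*} [Ring R] [AddCommGroup M] [Module Rᵐᵒᵖ M]
    (N : Submodule Rᵐᵒᵖ M) (r : R) : r ∈ annihilator N ↔ ∀ v ∈ N, op r • v = 0 := by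
  simp only [annihilator, TwoSidedIdeal.mem_mk', Set.mem_ofPred_eq]

/-- `N` is a prime module: it is nonzero and every nonzero submodule of `N` has the same
annihilator as `N`. -/
def IsPrimeSubmodule {R M : Type*} [Ring R] [AddCommGroup M] [Module Rᵐᵒᵖ M]
    (N : Submodule Rᵐᵒᵖ M) : Prop :=
  N ≠ ⊥ ∧ ∀ N' : Submodule Rᵐᵒᵖ M, N' ≤ N → N' ≠ ⊥ → annihilator N = annihilator N'

/-- Prime ideals of a not necessarily commutative ring: `P` is proper and `a R b ⊆ P` implies
`a ∈ P` or `b ∈ P`. -/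
def IsPrimeIdeal {R : Type*} [Ring R] (P : TwoSidedIdeal R) : Prop :=
  P ≠ ⊤ ∧ ∀ a b : R, (∀ r : R, a * r * b ∈ P) → a ∈ P ∨ b ∈ P

/-- The set `Ass(M_R)` of associated prime ideals of a right module. -/
def Ass (R M : Type*) [Ring R] [AddCommGroup M] [Module Rᵐᵒᵖ M] : Set (TwoSidedIdeal R) :=
  {P | IsPrimeIdeal P ∧ ∃ N : Submodule Rᵐᵒᵖ M, IsPrimeSubmodule N ∧ P = annihilator N}

/-- Every nonzero submodule of `M` contains a prime submodule. -/
def HasEnoughPrimeSubmodules (R M : Type*) [Ring R] [AddCommGroup M] [Module Rᵐᵒᵖ M] : Prop :=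
  ∀ N : Submodule Rᵐᵒᵖ M, N ≠ ⊥ → ∃ N' : Submodule Rᵐᵒᵖ M, N' ≤ N ∧ IsPrimeSubmodule N'

end RightModule

/-- The standard monomial `x^α = x₁^α₁ ⋯ xₙ^αₙ` (factors in this order). -/
def stdMonomial {A : Type*} [Ring A] {n : ℕ} (x : Fin n → A) (α : Fin n →₀ ℕ) : A :=
  (List.ofFn fun i => x i ^ α i).prod

/-- `A` is a skew PBW extension `σ(R)⟨x₁, …, xₙ⟩` of `R`; the inclusion `R ⊆ A` is written as an
injective ring homomorphism `ι`. -/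
structure SkewPBWExtension (R A : Type*) [Ring R] [Ring A] (n : ℕ) where
  /-- the inclusion of the coefficient ring -/
  ι : R →+* A
  ι_injective : Function.Injective ι
  /-- the generators -/
  x : Fin n → A
  /-- `A` is a free left `R`-module on the standard monomials: each element of `A` is
  `∑ r_α x^α` for exactly one finitely supported family `(r_α)`. -/
  free : Function.Bijective
    fun c : (Fin n →₀ ℕ) →₀ R => c.sum fun α r => ι r * stdMonomial x α
  skew : ∀ (i : Fin n) (r : R), r ≠ 0 →
    ∃ c : R, c ≠ 0 ∧ ∃ s : R, x i * ι r - ι c * x i = ι s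
  comm : ∀ i j : Fin n, ∃ d : R, d ≠ 0 ∧ ∃ (s : R) (t : Fin n → R),
    x j * x i - ι d * (x i * x j) = ι s + ∑ k, ι (t k) * x k

namespace SkewPBWExtension

variable {R A : Type*} [Ring R] [Ring A] {n : ℕ} (E : SkewPBWExtension R A n)

/-- The standard monomial `x^α` of `A`. -/
def mon (α : Fin n →₀ ℕ) : A := stdMonomial E.x α

/-- The additive isomorphism `(r_α) ↦ ∑ r_α x^α`. -/
def ofCoeff : ((Fin n →₀ ℕ) →₀ R) ≃+ A :=
  AddEquiv.ofBijective
    (Finsupp.liftAddHom fun α => (AddMonoidHom.mulRight (E.mon α)).comp E.ι.toAddMonoidHom)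
    E.free

/-- The family of coefficients of an element of `A` on the standard monomials. -/
def coeff : A ≃+ ((Fin n →₀ ℕ) →₀ R) := E.ofCoeff.symm

theorem ofCoeff_apply (c : (Fin n →₀ ℕ) →₀ R) :
    E.ofCoeff c = c.sum fun α r => E.ι r * E.mon α := rfl

theorem sum_coeff (a : A) : ((E.coeff a).sum fun α r => E.ι r * E.mon α) = a :=
  E.ofCoeff.apply_symm_apply a

theorem ofCoeff_single (α : Fin n →₀ ℕ) (r : R) :
    E.ofCoeff (Finsupp.single α r) = E.ι r * E.mon α := by
  rw [ofCoeff_apply, Finsupp.sum_single_index]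
  simp

theorem coeff_mul_mon (α : Fin n →₀ ℕ) (r : R) :
    E.coeff (E.ι r * E.mon α) = Finsupp.single α r := by
  rw [← ofCoeff_single]
  exact E.ofCoeff.symm_apply_apply _

theorem coeff_mon (α : Fin n →₀ ℕ) : E.coeff (E.mon α) = Finsupp.single α 1 := by
  simpa using E.coeff_mul_mon α 1

theorem coeff_ι_mul (r : R) (a : A) (α : Fin n →₀ ℕ) :
    E.coeff (E.ι r * a) α = r * E.coeff a α := by
  have h : E.ι r * a = E.ofCoeff ((E.coeff a).mapRange (fun s => r * s) (mul_zero r)) := by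
    rw [ofCoeff_apply, Finsupp.sum_mapRange_index (by simp)]
    conv_lhs => rw [← E.sum_coeff a]
    simp [Finsupp.sum, Finset.mul_sum, mul_assoc]
  rw [h, coeff, AddEquiv.symm_apply_apply, Finsupp.mapRange_apply]

theorem mon_zero : E.mon 0 = 1 := by
  simp [mon, stdMonomial]

theorem mon_single (i : Fin n) : E.mon (Finsupp.single i 1) = E.x i := by
  have key : ∀ (m : ℕ) (y : Fin m → A) (k : Fin m),
      (List.ofFn fun j => if k = j then y j else 1).prod = y k := by
    intro m
    induction m with
    | zero => intro y k; exact k.elim0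
    | succ m ih =>
      intro y k
      rw [List.ofFn_succ, List.prod_cons]
      refine Fin.cases ?_ (fun k => ?_) k
      · have h1 : (List.ofFn fun j : Fin m => if (0 : Fin (m + 1)) = j.succ then y j.succ else 1)
            = List.replicate m 1 := by
          rw [← List.ofFn_const]
          congr 1
        rw [h1]
        simp
      · have h2 := ih (fun j => y j.succ) k
        simpa [Fin.succ_inj] using h2
  rw [mon, stdMonomial, ← key n E.x i]
  congr 2
  funext j
  by_cases h : i = j
  · subst h; simp
  · simp [h]

/-- The map `σ_i : R → R` with `x_i r = σ_i(r) x_i + δ_i(r)`: the coefficient of `x_i` in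
`x_i r`. -/
def sigma (i : Fin n) (r : R) : R := E.coeff (E.x i * E.ι r) (Finsupp.single i 1)

/-- The map `δ_i : R → R` with `x_i r = σ_i(r) x_i + δ_i(r)`: the constant coefficient of
`x_i r`. -/
def delta (i : Fin n) (r : R) : R := E.coeff (E.x i * E.ι r) 0

/-- The relation which determines `σ_i` and `δ_i`. -/
theorem x_mul (i : Fin n) (r : R) :
    E.x i * E.ι r = E.ι (E.sigma i r) * E.x i + E.ι (E.delta i r) := by
  by_cases hr : r = 0
  · subst hr; simp [sigma, delta]
  · obtain ⟨c, -, s, h⟩ := E.skew i r hr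
    have h1 : E.x i * E.ι r
        = E.ι c * E.mon (Finsupp.single i 1) + E.ι s * E.mon 0 := by
      rw [mon_single, mon_zero, mul_one, ← h]
      abel
    have hne : (Finsupp.single i 1 : Fin n →₀ ℕ) ≠ 0 := by simp
    have hc : E.sigma i r = c := by
      rw [sigma, h1, map_add, coeff_mul_mon, coeff_mul_mon]
      simp
    have hs : E.delta i r = s := by
      rw [delta, h1, map_add, coeff_mul_mon, coeff_mul_mon]
      simp
    rw [hc, hs, h1, mon_single, mon_zero, mul_one]

/-- `A` is bijective: each `σ_i` is bijective and, for `i < j`, the coefficient `d_{i,j}` in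
`x_j x_i - d_{i,j} x_i x_j ∈ R + R x₁ + ⋯ + R xₙ` is invertible. -/
def IsBijective : Prop :=
  (∀ i, Function.Bijective (E.sigma i)) ∧
  ∀ i j : Fin n, i < j → ∃ d : R, IsUnit d ∧ ∃ (s : R) (t : Fin n → R),
    E.x j * E.x i - E.ι d * (E.x i * E.x j) = E.ι s + ∑ k, E.ι (t k) * E.x k

/-- `A` is quantized: there are central invertible `q_i ∈ R`, fixed by every `σ_j` and killed by
every `δ_j`, with `δ_i σ_i = q_i σ_i δ_i`. -/
def IsQuantized : Prop :=
  ∃ q : Fin n → R,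
    (∀ i, q i ∈ Set.center R ∧ IsUnit (q i)) ∧
    (∀ i r, E.delta i (E.sigma i r) = q i * E.sigma i (E.delta i r)) ∧
    ∀ i j, E.sigma i (q j) = q j ∧ E.delta i (q j) = 0

/-- `σ^α = σ₁^α₁ ∘ ⋯ ∘ σₙ^αₙ`. -/
def sigmaPow (α : Fin n →₀ ℕ) : R → R :=
  (List.ofFn fun i => (E.sigma i)^[α i]).foldr (fun f g => f ∘ g) id

/-- `δ^β = δ₁^β₁ ∘ ⋯ ∘ δₙ^βₙ`. -/
def deltaPow (β : Fin n →₀ ℕ) : R → R :=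
  (List.ofFn fun i => (E.delta i)^[β i]).foldr (fun f g => f ∘ g) id

/-- `I` is `(Σ, Σ⁻¹)`-stable: `σ_i(I) = I` for all `i`. -/
def IsSigmaStable (I : Set R) : Prop := ∀ i, E.sigma i '' I = I

/-- `I` is `(Σ, Σ⁻¹, Δ)`-stable: `σ_i(I) = I` and `δ_i(I) ⊆ I` for all `i`. -/
def IsSigmaDeltaStable (I : Set R) : Prop := ∀ i, E.sigma i '' I = I ∧ E.delta i '' I ⊆ I

/-- `I_Δ = {a ∈ I | δ^β(a) ∈ I for all β}`. -/
def deltaPart (I : Set R) : Set R := {a | a ∈ I ∧ ∀ β, E.deltaPow β a ∈ I}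

/-- `I_{Σ,Δ} = {a ∈ I | σ^α(δ^β(a)) ∈ I for all α, β}`. -/
def sigmaDeltaPart (I : Set R) : Set R :=
  {a | a ∈ I ∧ ∀ α β, E.sigmaPow α (E.deltaPow β a) ∈ I}

/-- `I⟨X⟩`: the elements of `A` all of whose coefficients lie in `I`. -/
def extend (I : Set R) : Set A := {f | ∀ α, E.coeff f α ∈ I}

/-- The induced module `M⟨X⟩_A = M ⊗_R A` of a right `R`-module `M`: its elements are the finite
formal sums `∑ m_α x^α` with `m_α ∈ M`. -/
def InducedModule (_E : SkewPBWExtension R A n) (M : Type*) [AddCommGroup M] : Type _ :=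
  (Fin n →₀ ℕ) →₀ M

section Induced

variable {M : Type*} [AddCommGroup M]

instance : AddCommGroup (E.InducedModule M) :=
  inferInstanceAs (AddCommGroup ((Fin n →₀ ℕ) →₀ M))

/-- The coefficients of an element of the induced module. -/
def mcoeff : E.InducedModule M ≃+ ((Fin n →₀ ℕ) →₀ M) :=
  AddEquiv.refl ((Fin n →₀ ℕ) →₀ M)

/-- The element `v x^α` of the induced module. -/
def term (α : Fin n →₀ ℕ) : M →+ E.InducedModule M :=
  E.mcoeff.symm.toAddMonoidHom.comp (Finsupp.singleAddHom α)

theorem mcoeff_term (α : Fin n →₀ ℕ) (v : M) :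
    E.mcoeff (E.term α v) = Finsupp.single α v := rfl

theorem hom_ext {B : Type*} [AddCommGroup B] {f g : E.InducedModule M →+ B}
    (h : ∀ α v, f (E.term α v) = g (E.term α v)) : f = g :=
  Finsupp.addHom_ext h

theorem mext {m m' : E.InducedModule M} (h : ∀ γ, E.mcoeff m γ = E.mcoeff m' γ) : m = m' :=
  E.mcoeff.injective (Finsupp.ext h)

variable [Module Rᵐᵒᵖ M]

/-- `(m, ∑ r_γ x^γ) ↦ ∑ (m r_γ) x^γ`, biadditive. -/
def spread : M →+ A →+ E.InducedModule M :=
  AddMonoidHom.mk'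
    (fun v => AddMonoidHom.mk'
      (fun a => E.mcoeff.symm (Finsupp.mapRange (fun r : R => op r • v) (by simp) (E.coeff a)))
      (by
        intro a b
        refine E.mext fun γ => ?_
        simp [add_smul]))
    (by
      intro v w
      refine AddMonoidHom.ext fun a => E.mext fun γ => ?_
      simp)

theorem mcoeff_spread (v : M) (a : A) (γ : Fin n →₀ ℕ) :
    E.mcoeff (E.spread v a) γ = op (E.coeff a γ) • v := by
  simp [spread]

theorem spread_ι_mul (v : M) (r : R) (a : A) :
    E.spread v (E.ι r * a) = E.spread (op r • v) a := by
  refine E.mext fun γ => ?_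
  rw [mcoeff_spread, mcoeff_spread, coeff_ι_mul, op_mul, mul_smul]

theorem spread_mon (v : M) (α : Fin n →₀ ℕ) : E.spread v (E.mon α) = E.term α v := by
  refine E.mext fun γ => ?_
  rw [mcoeff_spread, coeff_mon, mcoeff_term]
  by_cases hγ : α = γ
  · subst hγ; simp
  · simp [Finsupp.single_eq_of_ne' hγ]

/-- Right multiplication by `a ∈ A` on the induced module:
`(∑ m_α x^α) a = ∑ m_α (x^α a)`, where `x^α a` is expanded on the standard monomials and
`m (r x^γ) = (m r) x^γ`. -/
def act (a : A) : E.InducedModule M →+ E.InducedModule M :=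
  (Finsupp.liftAddHom fun α => (AddMonoidHom.flip E.spread) (E.mon α * a)).comp
    E.mcoeff.toAddMonoidHom

theorem act_term (a : A) (α : Fin n →₀ ℕ) (v : M) :
    E.act a (E.term α v) = E.spread v (E.mon α * a) :=
  Finsupp.liftAddHom_apply_single _ _ _

theorem act_spread (v : M) (a b : A) : E.act b (E.spread v a) = E.spread v (a * b) := by
  have h : ∀ c : (Fin n →₀ ℕ) →₀ R,
      E.act b (E.spread v (E.ofCoeff c)) = E.spread v (E.ofCoeff c * b) := by
    intro c
    induction c using Finsupp.induction_linear with
    | zero => simp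
    | add c d hc hd => simp only [map_add, add_mul, hc, hd]
    | single α r =>
      rw [ofCoeff_single, mul_assoc, spread_ι_mul, spread_ι_mul, spread_mon, act_term]
  simpa [coeff] using h (E.coeff a)

/-- The right `A`-module structure of the induced module. -/
instance : Module Aᵐᵒᵖ (E.InducedModule M) where
  smul a m := E.act a.unop m
  one_smul := by
    intro m
    have h : E.act (1 : A) = AddMonoidHom.id (E.InducedModule M) := by
      refine E.hom_ext fun α v => ?_
      rw [act_term, mul_one, AddMonoidHom.id_apply, spread_mon]
    exact DFunLike.congr_fun h m
  mul_smul := by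
    intro a b m
    have h : E.act (b.unop * a.unop)
        = (E.act a.unop).comp (E.act (M := M) b.unop) := by
      refine E.hom_ext fun α v => ?_
      rw [act_term, AddMonoidHom.comp_apply, act_term, act_spread, mul_assoc]
    exact DFunLike.congr_fun h m
  smul_zero := fun a => map_zero (E.act a.unop)
  smul_add := fun a => map_add (E.act a.unop)
  add_smul := by
    intro a b m
    have h : E.act (a.unop + b.unop) = E.act (M := M) a.unop + E.act b.unop := by
      refine E.hom_ext fun α v => ?_
      rw [AddMonoidHom.add_apply, act_term, act_term, act_term, mul_add, map_add]
    exact DFunLike.congr_fun h m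
  zero_smul := by
    intro m
    have h : E.act (0 : A) = (0 : E.InducedModule M →+ E.InducedModule M) := by
      refine E.hom_ext fun α v => ?_
      rw [act_term, mul_zero, map_zero, AddMonoidHom.zero_apply]
    exact DFunLike.congr_fun h m

/-- The defining formula `(v x^α) a = v (x^α a)` of the module structure. -/
theorem op_smul_term (a : A) (α : Fin n →₀ ℕ) (v : M) :
    op a • E.term α v = E.spread v (E.mon α * a) :=
  E.act_term a α v

/-- The exponent `α` of the leading monomial `lm(m) = x^α` of a nonzero `m ∈ M⟨X⟩`, with respect
to the order `ord` on the monomials (the value at `m = 0` is `0` and is never used). -/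
def leadExp (ord : MonomialOrder (Fin n)) (m : E.InducedModule M) : Fin n →₀ ℕ :=
  ord.toSyn.symm ((E.mcoeff m).support.sup ord.toSyn)

/-- `m ≠ 0` is a good polynomial: `lm(m r) = lm(m)` for every `r ∈ R` with `m r ≠ 0`. -/
def IsGoodPolynomial (ord : MonomialOrder (Fin n)) (m : E.InducedModule M) : Prop :=
  m ≠ 0 ∧ ∀ r : R, op (E.ι r) • m ≠ 0 → E.leadExp ord (op (E.ι r) • m) = E.leadExp ord m

end Induced

/-- `M⟨X⟩_A` is good: for every good polynomial `m` and every monomial `x^β` which is a multiple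
of `lm(m)` (exponents are compared componentwise), the submodule `m A` contains a good polynomial
with leading monomial `x^β`. -/
def IsGoodModule (M : Type*) [AddCommGroup M] [Module Rᵐᵒᵖ M] (ord : MonomialOrder (Fin n)) :
    Prop :=
  ∀ m : E.InducedModule M, E.IsGoodPolynomial ord m →
    ∀ β : Fin n →₀ ℕ, E.leadExp ord m ≤ β →
      ∃ f ∈ Submodule.span Aᵐᵒᵖ {m}, E.IsGoodPolynomial ord f ∧ E.leadExp ord f = β

end SkewPBWExtension

/-- A monomial order is degree compatible if `|α| < |β|` implies `x^α ≺ x^β`. -/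
def MonomialOrder.IsDegreeCompatible {n : ℕ} (ord : MonomialOrder (Fin n)) : Prop :=
  ∀ α β : Fin n →₀ ℕ, α.degree < β.degree → ord.toSyn α < ord.toSyn β

end

/-!
Let `Q` be the annihilator of a prime submodule of `M⟨X⟩`; it is also the annihilator of `m A` for
every nonzero `m` in that submodule. An element of the submodule with the smallest leading monomial
is good, and after multiplication by an element of `R` its leading coefficient `v` lies in a prime
submodule of `M`, with annihilator `P`. If `x^α` is the leading monomial of such an `m`, then
`m R a = 0` if and only if `σ^α(a) ∈ P` (`IsGoodLead.forall_smul_eq_zero_iff`). Moreover, if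
`f = ∑ r_γ x^γ` kills `m R`, then no cancellation is possible between the leading terms of the
`m r r_γ x^γ`, so every coefficient `r_γ` kills `m R` (`IsGoodLead.smul_coeff_eq_zero`). Hence all
coefficients of elements of `Q` lie in `σ^{-α}(P)`.

An upper bound `Q ⊆ I⟨X⟩` by an ideal `I` with `σ_i(I) ⊆ I` improves itself: `f ∈ Q` implies
`x_i f ∈ Q`, and the coefficients of `x_i f` are, modulo `I`, the `δ_i(r_γ)`. Iterating, `Q ⊆ J⟨X⟩`
for the largest ideal `J ⊆ I` invariant under all `σ_i` and `δ_i` (`subset_extend_deltaCore`). This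
uses that the ideal `{a ∈ I | δ_i(a) ∈ I for all i}` is again mapped into itself by the `σ_i`, which
holds because `δ_j σ_i` and `σ_i δ_j` agree up to a unit modulo such ideals
(`deltaHom_sigmaHom_mem_iff`). The ideal `J` is `{a | δ^β(a) ∈ I for all β}`, although the `δ_i` do
not commute, because `δ^β(a)` is the constant coefficient of `x^β a` (`mem_deltaIter_iff`).
Conversely, if `m R J = 0` for an ideal `J` invariant under all `σ_i` and `δ_i`, then
`J⟨X⟩ ⊆ Q` (`IsGoodLead.extend_subset_annihilator`).

When the associated primes of `M` are `σ`-stable, `σ^{-α}(P) = P`, and the two inclusions give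
`Q = P⟨X⟩` or `Q = P_Δ⟨X⟩`. When `M⟨X⟩` is good, `m A` contains good elements with leading monomial
`x^(α+β)` for every `β`, and their leading coefficients lie in `v R`. Let `J_λ` be the largest
ideal invariant under all `σ_i` and `δ_i` on which every `σ^(λ+γ)` takes values in `P`. The same two
inclusions give `Q = J_(α+β)⟨X⟩` for every `β`, so `J_(α+β)` does not depend on `β`. Since
`J_(λ+e_i) = σ_i^{-1}(J_λ)`, it follows that `J_λ` does not depend on `λ` at all; thus `Q = J_0⟨X⟩`
with `J_0 = P_{Σ,Δ}`, and `σ_i(J_0) = J_0`.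
-/

noncomputable section

namespace SkewPBWExtension

variable {R A : Type*} [Ring R] [Ring A] {n : ℕ} (E : SkewPBWExtension R A n)

/-! ### The maps `σ_i` and `δ_i` -/

theorem sigma_delta_unique {i : Fin n} {r c s : R}
    (h : E.x i * E.ι r = E.ι c * E.x i + E.ι s) : E.sigma i r = c ∧ E.delta i r = s := by
  have h1 : E.x i * E.ι r = E.ι c * E.mon (Finsupp.single i 1) + E.ι s * E.mon 0 := by
    rw [mon_single, mon_zero, mul_one, h]
  constructor
  · rw [sigma, h1, map_add, coeff_mul_mon, coeff_mul_mon]; simp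
  · rw [delta, h1, map_add, coeff_mul_mon, coeff_mul_mon]; simp

theorem sigma_delta_mul (i : Fin n) (r s : R) :
    E.sigma i (r * s) = E.sigma i r * E.sigma i s ∧
      E.delta i (r * s) = E.sigma i r * E.delta i s + E.delta i r * s := by
  apply sigma_delta_unique
  rw [map_mul, ← mul_assoc, x_mul, add_mul, mul_assoc, x_mul]
  simp only [map_add, map_mul, mul_add, mul_assoc, add_assoc]

/-- The coefficient map `σ_i` as a ring endomorphism of `R`. -/
def sigmaHom (i : Fin n) : R →+* R where
  toFun := E.sigma i
  map_one' := (E.sigma_delta_unique (r := 1) (c := 1) (s := 0) (by simp)).1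
  map_mul' r s := (E.sigma_delta_mul i r s).1
  map_zero' := by simp [sigma]
  map_add' r s := by simp [sigma, mul_add]

theorem sigmaHom_apply (i : Fin n) (r : R) : E.sigmaHom i r = E.sigma i r := rfl

/-- The `σ_i`-derivation `δ_i` as an additive endomorphism of `R`. -/
def deltaHom (i : Fin n) : R →+ R where
  toFun := E.delta i
  map_zero' := by simp [delta]
  map_add' r s := by simp [delta, mul_add]

theorem deltaHom_apply (i : Fin n) (r : R) : E.deltaHom i r = E.delta i r := rfl

theorem x_mul_hom (i : Fin n) (r : R) :
    E.x i * E.ι r = E.ι (E.sigmaHom i r) * E.x i + E.ι (E.deltaHom i r) := E.x_mul i r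

theorem deltaHom_mul (i : Fin n) (r s : R) :
    E.deltaHom i (r * s) = E.sigmaHom i r * E.deltaHom i s + E.deltaHom i r * s :=
  (E.sigma_delta_mul i r s).2

/-! ### Words in the generators -/

/-- The product `x_{i₁} ⋯ x_{iₖ}` along a word `l = [i₁, …, iₖ]`. -/
def word (l : List (Fin n)) : A := (l.map E.x).prod

@[simp] theorem word_nil : E.word [] = 1 := rfl

@[simp] theorem word_cons (i : Fin n) (l : List (Fin n)) :
    E.word (i :: l) = E.x i * E.word l := by simp [word]

theorem word_append (l l' : List (Fin n)) : E.word (l ++ l') = E.word l * E.word l' := by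
  simp [word]

/-- The composite `σ_{i₁} ∘ ⋯ ∘ σ_{iₖ}` along a word. -/
def sigmaWord : List (Fin n) → R →+* R
  | [] => RingHom.id R
  | i :: l => (E.sigmaHom i).comp (sigmaWord l)

@[simp] theorem sigmaWord_nil (r : R) : E.sigmaWord [] r = r := rfl

@[simp] theorem sigmaWord_cons (i : Fin n) (l : List (Fin n)) (r : R) :
    E.sigmaWord (i :: l) r = E.sigmaHom i (E.sigmaWord l r) := rfl

theorem sigmaWord_append (l l' : List (Fin n)) (r : R) :
    E.sigmaWord (l ++ l') r = E.sigmaWord l (E.sigmaWord l' r) := by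
  induction l with
  | nil => rfl
  | cons i l ih => simp [ih]

theorem sigmaHom_surjective (hE : E.IsBijective) (i : Fin n) :
    Function.Surjective (E.sigmaHom i) := (hE.1 i).2

theorem sigmaWord_surjective (hE : E.IsBijective) (l : List (Fin n)) :
    Function.Surjective (E.sigmaWord l) := by
  induction l with
  | nil => exact fun r => ⟨r, rfl⟩
  | cons i l ih => exact (E.sigmaHom_surjective hE i).comp ih

/-- The composite `δ_{i₁} ∘ ⋯ ∘ δ_{iₖ}` along a word. -/
def deltaWord : List (Fin n) → R →+ R
  | [] => AddMonoidHom.id R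
  | i :: l => (E.deltaHom i).comp (deltaWord l)

@[simp] theorem deltaWord_nil (r : R) : E.deltaWord [] r = r := rfl

@[simp] theorem deltaWord_cons (i : Fin n) (l : List (Fin n)) (r : R) :
    E.deltaWord (i :: l) r = E.deltaHom i (E.deltaWord l r) := rfl

/-- The weakly increasing word with `α i` letters `i`. -/
def stdWord (α : Fin n →₀ ℕ) : List (Fin n) :=
  (List.finRange n).flatMap fun i => List.replicate (α i) i

theorem count_stdWord (α : Fin n →₀ ℕ) (i : Fin n) : (stdWord α).count i = α i := by
  rw [stdWord, List.count_flatMap, ← List.ofFn_eq_map, List.sum_ofFn]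
  rw [Finset.sum_eq_single i]
  · simp
  · intro j _ hj
    simp [List.count_replicate, hj]
  · simp

theorem stdWord_pairwise (α : Fin n →₀ ℕ) : (stdWord α).Pairwise (· ≤ ·) := by
  rw [stdWord, List.pairwise_flatMap]
  refine ⟨fun i _ => by simp [List.pairwise_replicate], ?_⟩
  refine (List.pairwise_lt_finRange n).imp ?_
  intro i j hij a ha b hb
  rw [List.eq_of_mem_replicate ha, List.eq_of_mem_replicate hb]
  exact hij.le

/-- The exponent vector of a word. -/
def expOf (l : List (Fin n)) : Fin n →₀ ℕ := Multiset.toFinsupp (l : Multiset (Fin n))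

theorem expOf_apply (l : List (Fin n)) (i : Fin n) : expOf l i = l.count i := by
  simp [expOf]

theorem expOf_stdWord (α : Fin n →₀ ℕ) : expOf (stdWord α) = α := by
  ext i; rw [expOf_apply, count_stdWord]

theorem stdWord_expOf_perm (l : List (Fin n)) : (stdWord (expOf l)).Perm l := by
  rw [List.perm_iff_count]
  intro i
  rw [count_stdWord, expOf_apply]

theorem stdWord_expOf {l : List (Fin n)} (hl : l.Pairwise (· ≤ ·)) : stdWord (expOf l) = l :=
  (stdWord_expOf_perm l).eq_of_sortedLE (stdWord_pairwise _).sortedLE hl.sortedLE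

theorem expOf_cons (i : Fin n) (l : List (Fin n)) :
    expOf (i :: l) = expOf l + Finsupp.single i 1 := by
  ext j
  simp [expOf_apply, List.count_cons, Finsupp.single_apply]

theorem degree_expOf (l : List (Fin n)) : (expOf l).degree = l.length := by
  induction l with
  | nil => simp [expOf]
  | cons i l ih => rw [expOf_cons, map_add, ih]; simp

theorem length_stdWord (α : Fin n →₀ ℕ) : (stdWord α).length = α.degree := by
  rw [← degree_expOf, expOf_stdWord]

theorem stdWord_add_perm (α β : Fin n →₀ ℕ) :
    (stdWord α ++ stdWord β).Perm (stdWord (α + β)) := by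
  rw [List.perm_iff_count]
  intro i
  simp [count_stdWord]

theorem mon_eq_word (α : Fin n →₀ ℕ) : E.mon α = E.word (stdWord α) := by
  rw [mon, stdMonomial, word, stdWord, List.ofFn_eq_map, List.map_flatMap, List.flatMap,
    List.prod_flatten, List.map_map]
  congr 2
  funext i
  simp

theorem word_eq_mon {l : List (Fin n)} (hl : l.Pairwise (· ≤ ·)) :
    E.word l = E.mon (expOf l) := by
  rw [mon_eq_word, stdWord_expOf hl]

/-- Composing iterates along the blocks of a word is the same as composing letter by letter. -/
theorem foldr_iterate_eq {ι S : Type*} (F : ι → S → S) (α : ι → ℕ) (L : List ι) (r : S) :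
    (L.map fun i => (F i)^[α i]).foldr (fun f g => f ∘ g) id r =
      (L.flatMap fun i => List.replicate (α i) i).foldr F r := by
  induction L with
  | nil => rfl
  | cons i L ih =>
    have h : ∀ (k : ℕ) (s : S), (List.replicate k i).foldr F s = (F i)^[k] s := by
      intro k s
      induction k with
      | zero => rfl
      | succ k ihk => rw [List.replicate_succ, List.foldr_cons, ihk, Function.iterate_succ_apply']
    simp only [List.map_cons, List.foldr_cons, List.flatMap_cons, List.foldr_append, h,
      Function.comp_apply, ih]

theorem sigmaWord_eq_foldr (l : List (Fin n)) (r : R) :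
    E.sigmaWord l r = l.foldr E.sigma r := by
  induction l with
  | nil => rfl
  | cons i l ih => simp [ih, sigmaHom_apply]

theorem deltaWord_eq_foldr (l : List (Fin n)) (r : R) :
    E.deltaWord l r = l.foldr E.delta r := by
  induction l with
  | nil => rfl
  | cons i l ih => simp [ih, deltaHom_apply]

theorem sigmaPow_eq (α : Fin n →₀ ℕ) (r : R) :
    E.sigmaPow α r = E.sigmaWord (stdWord α) r := by
  rw [sigmaPow, List.ofFn_eq_map, foldr_iterate_eq, sigmaWord_eq_foldr, stdWord]

theorem deltaPow_eq (α : Fin n →₀ ℕ) (r : R) :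
    E.deltaPow α r = E.deltaWord (stdWord α) r := by
  rw [deltaPow, List.ofFn_eq_map, foldr_iterate_eq, deltaWord_eq_foldr, stdWord]

/-! ### Commutation of the coefficient maps -/

/-- The relation `x_j x_i = d x_i x_j + (lower terms)`, read on the coefficients of
`x_i x_j`, `x_i` and `x_j` in `(x_j x_i) r` for `i < j`. -/
theorem comm_relations_of_lt {i j : Fin n} (hij : i < j) {d s : R} {t : Fin n → R}
    (h : E.x j * E.x i - E.ι d * (E.x i * E.x j) = E.ι s + ∑ k, E.ι (t k) * E.x k) (r : R) :
    E.sigmaHom j (E.sigmaHom i r) * d = d * E.sigmaHom i (E.sigmaHom j r) ∧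
    E.sigmaHom j (E.sigmaHom i r) * t i + E.deltaHom j (E.sigmaHom i r)
      = d * E.sigmaHom i (E.deltaHom j r) + t i * E.sigmaHom i r ∧
    E.sigmaHom j (E.sigmaHom i r) * t j + E.sigmaHom j (E.deltaHom i r)
      = d * E.deltaHom i (E.sigmaHom j r) + t j * E.sigmaHom j r := by
  have hxx : E.x i * E.x j = E.mon (Finsupp.single i 1 + Finsupp.single j 1) := by
    have h1 := E.word_eq_mon (l := [i, j]) (by simpa using hij.le)
    simp only [expOf_cons, word_cons, word_nil, mul_one] at h1
    rw [h1]
    congr 1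
    have h0 : expOf ([] : List (Fin n)) = 0 := by simp [expOf]
    rw [h0, zero_add, add_comm]
  have h' := sub_eq_iff_eq_add.1 h
  have key : E.ι (E.sigmaHom j (E.sigmaHom i r)) *
        (E.ι s + ∑ k, E.ι (t k) * E.x k + E.ι d * (E.x i * E.x j))
        + E.ι (E.deltaHom j (E.sigmaHom i r)) * E.x i
        + E.ι (E.sigmaHom j (E.deltaHom i r)) * E.x j
        + E.ι (E.deltaHom j (E.deltaHom i r)) =
      E.ι s * E.ι r + ∑ k, (E.ι (t k) * E.ι (E.sigmaHom k r) * E.x k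
          + E.ι (t k) * E.ι (E.deltaHom k r))
        + (E.ι d * E.ι (E.sigmaHom i (E.sigmaHom j r)) * (E.x i * E.x j)
        + E.ι d * E.ι (E.deltaHom i (E.sigmaHom j r)) * E.x j
        + E.ι d * E.ι (E.sigmaHom i (E.deltaHom j r)) * E.x i
        + E.ι d * E.ι (E.deltaHom i (E.deltaHom j r))) := by
    have hl : E.x j * E.x i * E.ι r = E.ι (E.sigmaHom j (E.sigmaHom i r)) * (E.x j * E.x i)
        + E.ι (E.deltaHom j (E.sigmaHom i r)) * E.x i
        + E.ι (E.sigmaHom j (E.deltaHom i r)) * E.x j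
        + E.ι (E.deltaHom j (E.deltaHom i r)) := by
      rw [mul_assoc, x_mul_hom, mul_add, ← mul_assoc, x_mul_hom, x_mul_hom, add_mul, mul_assoc]
      abel
    have hr : E.x i * E.x j * E.ι r = E.ι (E.sigmaHom i (E.sigmaHom j r)) * (E.x i * E.x j)
        + E.ι (E.deltaHom i (E.sigmaHom j r)) * E.x j
        + E.ι (E.sigmaHom i (E.deltaHom j r)) * E.x i
        + E.ι (E.deltaHom i (E.deltaHom j r)) := by
      rw [mul_assoc, x_mul_hom, mul_add, ← mul_assoc, x_mul_hom, x_mul_hom, add_mul, mul_assoc]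
      abel
    rw [← h', ← hl, h', add_mul, add_mul, Finset.sum_mul, mul_assoc (E.ι d), hr]
    simp only [mul_assoc, x_mul_hom, mul_add]
  have hc : ∀ (c : R) (k : Fin n), E.coeff (E.ι c * E.x k)
      = Finsupp.single (Finsupp.single k 1) c := by
    intro c k; rw [← mon_single, coeff_mul_mon]
  have hc0 : ∀ c : R, E.coeff (E.ι c) = Finsupp.single 0 c := by
    intro c; rw [← E.coeff_mul_mon, mon_zero, mul_one]
  have hc2 : ∀ c : R, E.coeff (E.ι c * (E.x i * E.x j))
      = Finsupp.single (Finsupp.single i 1 + Finsupp.single j 1) c := by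
    intro c; rw [hxx, coeff_mul_mon]
  simp only [mul_add, Finset.mul_sum, ← mul_assoc, ← map_mul] at key
  simp only [mul_assoc _ (E.x i) (E.x j)] at key
  have key' := congrArg E.coeff key
  simp only [map_add, map_sum, hc, hc0, hc2] at key'
  have hne := hij.ne
  have e1 : (Finsupp.single i 1 + Finsupp.single j 1 : Fin n →₀ ℕ) ≠ 0 := by
    intro h0; simpa using DFunLike.congr_fun h0 i
  have e2 : ∀ k : Fin n,
      (Finsupp.single i 1 + Finsupp.single j 1 : Fin n →₀ ℕ) ≠ Finsupp.single k 1 := by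
    intro k h0
    simpa using congrArg Finsupp.degree h0
  have e3 : ∀ k l : Fin n, (Finsupp.single k 1 : Fin n →₀ ℕ) = Finsupp.single l 1 ↔ k = l :=
    fun k l => Finsupp.single_left_inj one_ne_zero
  have e4 : ∀ k : Fin n, (0 : Fin n →₀ ℕ) ≠ Finsupp.single k 1 :=
    fun k h0 => by simpa using congrArg Finsupp.degree h0
  refine ⟨?_, ?_, ?_⟩
  · have := DFunLike.congr_fun key' (Finsupp.single i 1 + Finsupp.single j 1)
    simpa [Finsupp.single_apply, e1, e1.symm, e2, (e2 _).symm, Finsupp.finsetSum_apply] using this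
  · have := DFunLike.congr_fun key' (Finsupp.single i 1)
    simpa [Finsupp.single_apply, e2, e3, e4, hne, hne.symm, Finsupp.finsetSum_apply, add_comm]
      using this
  · have := DFunLike.congr_fun key' (Finsupp.single j 1)
    simpa [Finsupp.single_apply, e2, e3, e4, hne, hne.symm, Finsupp.finsetSum_apply, add_comm]
      using this

/-- In a bijective extension every pair of generators commutes up to a unit and lower terms, in
either order. -/
theorem exists_unit_comm (hE : E.IsBijective) (i j : Fin n) :
    ∃ d : Rˣ, ∃ (s : R) (t : Fin n → R),
      E.x j * E.x i = E.ι d * (E.x i * E.x j) + (E.ι s + ∑ k, E.ι (t k) * E.x k) := by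
  rcases lt_trichotomy i j with hij | rfl | hij
  · obtain ⟨d, ⟨u, rfl⟩, s, t, h⟩ := hE.2 i j hij
    exact ⟨u, s, t, sub_eq_iff_eq_add'.1 h⟩
  · exact ⟨1, 0, 0, by simp⟩
  · obtain ⟨d, ⟨u, rfl⟩, s, t, h⟩ := hE.2 j i hij
    refine ⟨u⁻¹, -(↑u⁻¹ * s), fun k => -(↑u⁻¹ * t k), ?_⟩
    have h1 := sub_eq_iff_eq_add'.1 h
    rw [h1]
    simp only [mul_add, ← mul_assoc, ← map_mul, Units.inv_mul, map_one, one_mul, map_neg, neg_mul,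
      Finset.mul_sum, Finset.sum_neg_distrib]
    abel

theorem sigmaHom_comm (hE : E.IsBijective) (i j : Fin n) :
    ∃ d : Rˣ, ∀ r, E.sigmaHom j (E.sigmaHom i r) * d = d * E.sigmaHom i (E.sigmaHom j r) := by
  rcases lt_trichotomy i j with hij | rfl | hij
  · obtain ⟨d, ⟨u, rfl⟩, s, t, h⟩ := hE.2 i j hij
    exact ⟨u, fun r => (E.comm_relations_of_lt hij h r).1⟩
  · exact ⟨1, by simp⟩
  · obtain ⟨d, ⟨u, rfl⟩, s, t, h⟩ := hE.2 j i hij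
    refine ⟨u⁻¹, fun r => ?_⟩
    have h1 := (E.comm_relations_of_lt hij h r).1
    rw [Units.mul_inv_eq_iff_eq_mul, mul_assoc, h1, Units.inv_mul_cancel_left]

/-- `δ_j σ_i` and `σ_i δ_j` agree up to a unit and a term which is controlled by `σ_i(r)` and
`σ_j σ_i(r)`. For `i ≠ j` this follows from the relations between the generators; only `i = j` uses
that the extension is quantized. -/
theorem deltaHom_sigmaHom_comm (hE : E.IsBijective) (hq : E.IsQuantized) (i j : Fin n) :
    ∃ (u : Rˣ) (t : R), ∀ r, E.deltaHom j (E.sigmaHom i r) =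
      u * E.sigmaHom i (E.deltaHom j r) +
        (t * E.sigmaHom i r - E.sigmaHom j (E.sigmaHom i r) * t) := by
  rcases lt_trichotomy i j with hij | rfl | hij
  · obtain ⟨d, ⟨u, rfl⟩, s, t, h⟩ := hE.2 i j hij
    refine ⟨u, t i, fun r => ?_⟩
    rw [← add_sub_assoc, ← (E.comm_relations_of_lt hij h r).2.1, add_sub_cancel_left]
  · obtain ⟨q, hq1, hq2, -⟩ := hq
    obtain ⟨u, hu⟩ := (hq1 i).2
    refine ⟨u, 0, fun r => ?_⟩
    rw [hu, zero_mul, mul_zero, sub_zero, add_zero]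
    exact hq2 i r
  · obtain ⟨d, ⟨u, rfl⟩, s, t, h⟩ := hE.2 j i hij
    refine ⟨u⁻¹, -(↑u⁻¹ * t i), fun r => ?_⟩
    obtain ⟨h1, -, h3⟩ := E.comm_relations_of_lt hij h r
    have h1' : E.sigmaHom j (E.sigmaHom i r) * ↑u⁻¹ = ↑u⁻¹ * E.sigmaHom i (E.sigmaHom j r) := by
      rw [Units.mul_inv_eq_iff_eq_mul, mul_assoc, h1, Units.inv_mul_cancel_left]
    have h3' : ↑u * E.deltaHom j (E.sigmaHom i r) = E.sigmaHom i (E.sigmaHom j r) * t i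
        + E.sigmaHom i (E.deltaHom j r) - t i * E.sigmaHom i r := by rw [h3, add_sub_cancel_right]
    rw [← u.inv_mul_cancel_left (E.deltaHom j (E.sigmaHom i r)), h3', mul_neg, ← mul_assoc, h1']
    simp only [mul_add, mul_sub, mul_assoc, neg_mul]
    abel

/-- Up to conjugation by a unit, `σ` along a word depends only on the letters of the word. -/
theorem sigmaWord_perm (hE : E.IsBijective) {l l' : List (Fin n)} (h : l.Perm l') :
    ∃ d : Rˣ, ∀ r, E.sigmaWord l r * d = d * E.sigmaWord l' r := by
  induction h with
  | nil => exact ⟨1, by simp⟩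
  | cons i _ ih =>
    obtain ⟨d, hd⟩ := ih
    refine ⟨Units.map (E.sigmaHom i).toMonoidHom d, fun r => ?_⟩
    have := congrArg (E.sigmaHom i) (hd r)
    simpa using this
  | swap i j l =>
    obtain ⟨d, hd⟩ := E.sigmaHom_comm hE i j
    exact ⟨d, fun r => hd _⟩
  | trans _ _ ih1 ih2 =>
    obtain ⟨d, hd⟩ := ih1
    obtain ⟨d', hd'⟩ := ih2
    refine ⟨d * d', fun r => ?_⟩
    rw [Units.val_mul, ← mul_assoc, hd, mul_assoc, hd', mul_assoc]

theorem sigmaWord_mem_iff_of_perm (hE : E.IsBijective) {l l' : List (Fin n)} (h : l.Perm l')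
    (I : TwoSidedIdeal R) (r : R) : E.sigmaWord l r ∈ I ↔ E.sigmaWord l' r ∈ I := by
  obtain ⟨d, hd⟩ := E.sigmaWord_perm hE h
  constructor
  · intro hr
    rw [← d.inv_mul_cancel_left (E.sigmaWord l' r), ← hd]
    exact I.mul_mem_left _ _ (I.mul_mem_right _ _ hr)
  · intro hr
    rw [← d.mul_inv_cancel_right (E.sigmaWord l r), hd]
    exact I.mul_mem_right _ _ (I.mul_mem_left _ _ hr)

/-! ### The degree filtration -/

/-- The additive subgroup of `A` generated by the `r x_{i₁} ⋯ x_{iₘ}` with `m < k`. -/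
def lowerWords (k : ℕ) : AddSubgroup A :=
  AddSubgroup.closure {a | ∃ (r : R) (l : List (Fin n)), l.length < k ∧ a = E.ι r * E.word l}

theorem ι_mul_word_mem_lowerWords (r : R) {l : List (Fin n)} {k : ℕ} (h : l.length < k) :
    E.ι r * E.word l ∈ E.lowerWords k := AddSubgroup.subset_closure ⟨r, l, h, rfl⟩

/-- To map `lowerWords k` into an additive subgroup, it suffices to map its generators. -/
theorem lowerWords_induction {B : Type*} [AddCommGroup B] {k : ℕ} (f : A →+ B) (S : AddSubgroup B)
    (h : ∀ (r : R) (l : List (Fin n)), l.length < k → f (E.ι r * E.word l) ∈ S) {a : A}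
    (ha : a ∈ E.lowerWords k) : f a ∈ S := by
  have : E.lowerWords k ≤ S.comap f := by
    rw [lowerWords, AddSubgroup.closure_le]
    rintro _ ⟨r, l, hl, rfl⟩
    exact h r l hl
  exact this ha

theorem ι_mul_mem_lowerWords (r : R) {k : ℕ} {a : A} (ha : a ∈ E.lowerWords k) :
    E.ι r * a ∈ E.lowerWords k :=
  E.lowerWords_induction (AddMonoidHom.mulLeft (E.ι r)) _ (fun s l hl => by
    rw [AddMonoidHom.coe_mulLeft, ← mul_assoc, ← map_mul]
    exact E.ι_mul_word_mem_lowerWords _ hl) ha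

theorem x_mul_mem_lowerWords (i : Fin n) {k : ℕ} {a : A} (ha : a ∈ E.lowerWords k) :
    E.x i * a ∈ E.lowerWords (k + 1) :=
  E.lowerWords_induction (AddMonoidHom.mulLeft (E.x i)) _ (fun s l hl => by
    rw [AddMonoidHom.coe_mulLeft, ← mul_assoc, x_mul_hom, add_mul, mul_assoc, ← word_cons]
    refine add_mem (E.ι_mul_word_mem_lowerWords _ ?_) (E.ι_mul_word_mem_lowerWords _ ?_)
    · simpa using hl
    · omega) ha

theorem mul_word_mem_lowerWords (l : List (Fin n)) {k : ℕ} {a : A} (ha : a ∈ E.lowerWords k) :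
    a * E.word l ∈ E.lowerWords (k + l.length) :=
  E.lowerWords_induction (AddMonoidHom.mulRight (E.word l)) _ (fun s l' hl => by
    rw [AddMonoidHom.mulRight_apply, mul_assoc, ← word_append]
    exact E.ι_mul_word_mem_lowerWords _ (by simp; omega)) ha

/-- `x_{i₁} ⋯ x_{iₖ} r = σ_{i₁} ⋯ σ_{iₖ}(r) x_{i₁} ⋯ x_{iₖ}` modulo lower terms. -/
theorem word_mul_ι (l : List (Fin n)) (r : R) :
    E.word l * E.ι r - E.ι (E.sigmaWord l r) * E.word l ∈ E.lowerWords l.length := by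
  induction l with
  | nil => simp
  | cons i l ih =>
    have h : E.word (i :: l) * E.ι r - E.ι (E.sigmaWord (i :: l) r) * E.word (i :: l) =
        E.x i * (E.word l * E.ι r - E.ι (E.sigmaWord l r) * E.word l)
          + E.ι (E.deltaHom i (E.sigmaWord l r)) * E.word l := by
      rw [mul_sub, ← mul_assoc (E.x i) (E.ι _), x_mul_hom, add_mul, word_cons, sigmaWord_cons]
      simp only [mul_assoc]
      abel
    rw [h]
    exact add_mem (E.x_mul_mem_lowerWords i ih) (E.ι_mul_word_mem_lowerWords _ (by simp))

/-- Permuting the letters of a word changes it by a unit factor and lower terms. -/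
theorem word_perm (hE : E.IsBijective) {l l' : List (Fin n)} (h : l.Perm l') :
    ∃ d : Rˣ, E.word l - E.ι d * E.word l' ∈ E.lowerWords l.length := by
  induction h with
  | nil => exact ⟨1, by simp⟩
  | @cons i l l' hp ih =>
    obtain ⟨d, hd⟩ := ih
    refine ⟨Units.map (E.sigmaHom i).toMonoidHom d, ?_⟩
    have h : E.word (i :: l) - E.ι (E.sigmaHom i d) * E.word (i :: l') =
        E.x i * (E.word l - E.ι d * E.word l') + E.ι (E.deltaHom i d) * E.word l' := by
      rw [mul_sub, ← mul_assoc (E.x i) (E.ι _), x_mul_hom, add_mul, word_cons, word_cons]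
      simp only [mul_assoc]
      abel
    change E.word (i :: l) - E.ι (E.sigmaHom i d) * E.word (i :: l') ∈ _
    rw [h]
    exact add_mem (E.x_mul_mem_lowerWords i hd)
      (E.ι_mul_word_mem_lowerWords _ (by simp [hp.length_eq]))
  | swap i j l =>
    obtain ⟨d, s, t, h⟩ := E.exists_unit_comm hE i j
    refine ⟨d, ?_⟩
    have h' : E.word (j :: i :: l) - E.ι d * E.word (i :: j :: l) =
        E.ι s * E.word l + ∑ k, E.ι (t k) * E.word (k :: l) := by
      simp only [word_cons, ← mul_assoc] at h ⊢
      rw [h]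
      simp only [add_mul, Finset.sum_mul]
      abel
    rw [h']
    refine add_mem (E.ι_mul_word_mem_lowerWords _ (by simp)) (sum_mem fun k _ => ?_)
    exact E.ι_mul_word_mem_lowerWords _ (by simp)
  | @trans l₁ l₂ l₃ h₁ _ ih1 ih2 =>
    obtain ⟨d, hd⟩ := ih1
    obtain ⟨d', hd'⟩ := ih2
    refine ⟨d * d', ?_⟩
    have h : E.word l₁ - E.ι ↑(d * d') * E.word l₃ = (E.word l₁ - E.ι d * E.word l₂)
        + E.ι d * (E.word l₂ - E.ι d' * E.word l₃) := by
      rw [Units.val_mul, map_mul, mul_sub, mul_assoc]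
      abel
    rw [h]
    exact add_mem hd (E.ι_mul_mem_lowerWords _ (h₁.length_eq ▸ hd'))

/-- Rewriting words on the standard monomials does not raise the degree: elements of `lowerWords k`
have degree `< k`. -/
theorem coeff_eq_zero_of_mem_lowerWords (hE : E.IsBijective) {k : ℕ} {a : A}
    (ha : a ∈ E.lowerWords k) {γ : Fin n →₀ ℕ} (hγ : k ≤ γ.degree) : E.coeff a γ = 0 := by
  induction k using Nat.strong_induction_on generalizing a γ with
  | _ k ih =>
  refine (AddSubgroup.mem_bot).1 (E.lowerWords_induction
    ((Finsupp.applyAddHom γ).comp E.coeff.toAddMonoidHom) ⊥ (fun r l hl => ?_) ha)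
  change E.coeff (E.ι r * E.word l) γ = 0
  obtain ⟨d, hd⟩ := E.word_perm hE (stdWord_expOf_perm l).symm
  rw [← sub_add_cancel (E.word l) (E.ι d * E.word (stdWord (expOf l))), coeff_ι_mul, map_add,
    Finsupp.add_apply, ih _ hl hd (by omega), ← mon_eq_word, coeff_mul_mon,
    Finsupp.single_eq_of_ne, add_zero, mul_zero]
  rintro rfl
  rw [degree_expOf] at hγ
  omega

/-- The leading term of the product of two monomials with a coefficient in between. -/
theorem exists_unit_mon_mul (hE : E.IsBijective) (α β : Fin n →₀ ℕ) :
    ∃ d : Rˣ, ∀ r, E.mon α * (E.ι r * E.mon β)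
      - E.ι (E.sigmaWord (stdWord α) r * d) * E.mon (α + β) ∈
        E.lowerWords (α + β).degree := by
  obtain ⟨d, hd⟩ := E.word_perm hE (stdWord_add_perm α β)
  refine ⟨d, fun r => ?_⟩
  have h1 := E.mul_word_mem_lowerWords (stdWord β) (E.word_mul_ι (stdWord α) r)
  have h2 := E.ι_mul_mem_lowerWords (E.sigmaWord (stdWord α) r) hd
  rw [List.length_append] at h2
  have h3 := add_mem h1 h2
  rw [length_stdWord, length_stdWord, ← map_add] at h3
  convert h3 using 1
  simp only [mon_eq_word, word_append, map_mul, mul_sub, sub_mul, mul_assoc]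
  abel

/-! ### The constant coefficient -/

/-- The elements supported on the monomials in which only `x_i, x_{i+1}, …` occur. They are generated
by weakly increasing words, which are standard monomials, so that left multiplication by `x_i` needs
no reordering. -/
def upperWords (i : Fin n) : AddSubgroup A :=
  AddSubgroup.closure {a | ∃ (r : R) (l : List (Fin n)), l.Pairwise (· ≤ ·) ∧ (∀ j ∈ l, i ≤ j) ∧
    a = E.ι r * E.word l}

theorem x_mul_upperWords (i : Fin n) {a : A} (ha : a ∈ E.upperWords i) :
    E.x i * a ∈ E.upperWords i ∧ E.coeff (E.x i * a) 0 = E.deltaHom i (E.coeff a 0) := by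
  have h0 : ∀ (r : R) {l : List (Fin n)}, l.Pairwise (· ≤ ·) →
      E.coeff (E.ι r * E.word l) 0 = if l = [] then r else 0 := by
    intro r l hl
    rw [E.word_eq_mon hl, coeff_mul_mon]
    by_cases h : l = []
    · subst h; simp [expOf]
    · rw [if_neg h, Finsupp.single_eq_of_ne]
      intro h0
      have := degree_expOf l
      rw [← h0] at this
      exact h (List.length_eq_zero_iff.1 (by simpa using this.symm))
  induction ha using AddSubgroup.closure_induction with
  | mem a ha =>
    obtain ⟨r, l, hl, hi, rfl⟩ := ha
    have hil : (i :: l).Pairwise (· ≤ ·) := List.pairwise_cons.2 ⟨hi, hl⟩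
    have h : E.x i * (E.ι r * E.word l) = E.ι (E.sigmaHom i r) * E.word (i :: l)
        + E.ι (E.deltaHom i r) * E.word l := by
      rw [← mul_assoc, x_mul_hom, add_mul, mul_assoc, word_cons]
    rw [h]
    constructor
    · refine add_mem (AddSubgroup.subset_closure ⟨_, _, hil, ?_, rfl⟩)
        (AddSubgroup.subset_closure ⟨_, _, hl, hi, rfl⟩)
      simpa using hi
    · rw [map_add, Finsupp.add_apply, h0 _ hil, h0 _ hl, h0 _ hl]
      by_cases h : l = [] <;> simp [h]
  | zero => simp
  | add a b _ _ iha ihb =>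
    rw [mul_add, map_add, map_add, Finsupp.add_apply, Finsupp.add_apply, map_add, iha.2, ihb.2]
    exact ⟨add_mem iha.1 ihb.1, rfl⟩
  | neg a _ ih =>
    rw [mul_neg, map_neg, map_neg, Finsupp.neg_apply, Finsupp.neg_apply, map_neg, ih.2]
    exact ⟨neg_mem ih.1, rfl⟩

theorem upperWords_mono {i j : Fin n} (h : i ≤ j) : E.upperWords j ≤ E.upperWords i :=
  AddSubgroup.closure_mono fun _ ⟨r, l, hl, hj, ha⟩ =>
    ⟨r, l, hl, fun k hk => h.trans (hj k hk), ha⟩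

/-- The constant coefficient of `x^α r` is `δ^α(r)`. -/
theorem coeff_mon_mul_ι (α : Fin n →₀ ℕ) (r : R) :
    E.coeff (E.mon α * E.ι r) 0 = E.deltaPow α r := by
  rw [mon_eq_word, deltaPow_eq]
  have key : ∀ l : List (Fin n), l.Pairwise (· ≤ ·) →
      (∀ i, (∀ j ∈ l, i ≤ j) → E.word l * E.ι r ∈ E.upperWords i) ∧
        E.coeff (E.word l * E.ι r) 0 = E.deltaWord l r := by
    intro l hl
    induction l with
    | nil =>
      constructor
      · intro i _
        exact AddSubgroup.subset_closure ⟨r, [], List.Pairwise.nil, by simp, by simp⟩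
      · have := E.coeff_mul_mon 0 r
        rw [mon_zero, mul_one] at this
        simp [this]
    | cons i l ih =>
      obtain ⟨hi, hl'⟩ := List.pairwise_cons.1 hl
      obtain ⟨ih1, ih2⟩ := ih hl'
      obtain ⟨h1, h2⟩ := E.x_mul_upperWords i (ih1 i hi)
      rw [word_cons, mul_assoc, h2, ih2]
      exact ⟨fun j hj => E.upperWords_mono (hj i (by simp)) h1, rfl⟩
  exact (key _ (stdWord_pairwise α)).2

end SkewPBWExtension

namespace SkewPBWExtension

variable {R A : Type*} [Ring R] [Ring A] {n : ℕ} (E : SkewPBWExtension R A n)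

/-! ### Invariant ideals -/

/-- A two-sided ideal of `R` mapped into itself by all `σ_i` (equality is not required). -/
def IsSigmaInvariant (I : TwoSidedIdeal R) : Prop := ∀ i, ∀ a ∈ I, E.sigmaHom i a ∈ I

variable {E}

theorem ι_mul_mem_extend {I : TwoSidedIdeal R} (r : R) {f : A}
    (hf : f ∈ E.extend (I : Set R)) : E.ι r * f ∈ E.extend (I : Set R) := fun α => by
  rw [coeff_ι_mul]; exact I.mul_mem_left _ _ (hf α)

theorem mem_mul_mem_extend {I : TwoSidedIdeal R} {r : R} (hr : r ∈ I) (f : A) :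
    E.ι r * f ∈ E.extend (I : Set R) := fun α => by
  rw [coeff_ι_mul]; exact I.mul_mem_right _ _ hr

theorem zero_mem_extend {I : TwoSidedIdeal R} : (0 : A) ∈ E.extend (I : Set R) := fun α => by
  rw [map_zero]; exact I.zero_mem

theorem add_mem_extend {I : TwoSidedIdeal R} {f g : A} (hf : f ∈ E.extend (I : Set R))
    (hg : g ∈ E.extend (I : Set R)) : f + g ∈ E.extend (I : Set R) := fun α => by
  rw [map_add]; exact I.add_mem (hf α) (hg α)

theorem sub_mem_extend {I : TwoSidedIdeal R} {f g : A} (hf : f ∈ E.extend (I : Set R))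
    (hg : g ∈ E.extend (I : Set R)) : f - g ∈ E.extend (I : Set R) := fun α => by
  rw [map_sub]; exact I.sub_mem (hf α) (hg α)

/-- `I⟨X⟩` is the right ideal of `A` generated by `I`. -/
theorem extend_induction {I : TwoSidedIdeal R} {p : A → Prop} (h0 : p 0)
    (hadd : ∀ f g, p f → p g → p (f + g)) (hI : ∀ r ∈ I, ∀ α, p (E.ι r * E.mon α))
    {f : A} (hf : f ∈ E.extend (I : Set R)) : p f := by
  rw [← E.sum_coeff f]
  exact Finset.sum_induction _ p hadd h0 fun α _ => hI _ (hf α) α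

theorem mul_mem_extend {I : TwoSidedIdeal R} {f : A} (hf : f ∈ E.extend (I : Set R)) (g : A) :
    f * g ∈ E.extend (I : Set R) :=
  extend_induction (p := fun f => f * g ∈ E.extend (I : Set R))
    (by rw [zero_mul]; exact zero_mem_extend)
    (fun f f' hf hf' => by rw [add_mul]; exact add_mem_extend hf hf')
    (fun r hr α => by rw [mul_assoc]; exact mem_mul_mem_extend hr _) hf

theorem extend_injective {I J : Set R} (h : E.extend I = E.extend J) (hI : 0 ∈ I) (hJ : 0 ∈ J) :
    I = J := by
  have key : ∀ {I : Set R}, 0 ∈ I → ∀ r, E.ι r ∈ E.extend I ↔ r ∈ I := by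
    intro I hI r
    have hr : E.coeff (E.ι r) = Finsupp.single 0 r := by
      rw [← E.coeff_mul_mon, mon_zero, mul_one]
    constructor
    · intro h
      have := h 0
      rwa [hr, Finsupp.single_eq_same] at this
    · intro h α
      rw [hr, Finsupp.single_apply]
      split_ifs
      · exact h
      · exact hI
  ext r
  rw [← key hI, ← key hJ, h]

/-- If `σ_i` and `δ_i` map `J` into `I`, then `x_i J⟨X⟩ ⊆ I⟨X⟩`. -/
theorem x_mul_mem_extend {I J : TwoSidedIdeal R} {i : Fin n}
    (hσ : ∀ a ∈ J, E.sigmaHom i a ∈ I) (hδ : ∀ a ∈ J, E.deltaHom i a ∈ I) {f : A}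
    (hf : f ∈ E.extend (J : Set R)) : E.x i * f ∈ E.extend (I : Set R) :=
  extend_induction (p := fun f => E.x i * f ∈ E.extend (I : Set R))
    (by rw [mul_zero]; exact zero_mem_extend)
    (fun f f' hf hf' => by rw [mul_add]; exact add_mem_extend hf hf')
    (fun r hr α => by
      rw [← mul_assoc, x_mul_hom, add_mul, mul_assoc]
      exact add_mem_extend (mem_mul_mem_extend (hσ r hr) _) (mem_mul_mem_extend (hδ r hr) _)) hf

/-- If `J` is invariant under all `σ_i` and `δ_i`, then `A J ⊆ J⟨X⟩`. -/
theorem mul_ι_mem_extend {J : TwoSidedIdeal R} (hσ : E.IsSigmaInvariant J)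
    (hδ : ∀ i, ∀ a ∈ J, E.deltaHom i a ∈ J) (f : A) {a : R} (ha : a ∈ J) :
    f * E.ι a ∈ E.extend (J : Set R) := by
  rw [← E.sum_coeff f, Finsupp.sum, Finset.sum_mul]
  refine Finset.sum_induction _ (· ∈ E.extend (J : Set R)) (fun _ _ => add_mem_extend)
    zero_mem_extend fun α _ => ?_
  rw [mul_assoc, mon_eq_word]
  refine ι_mul_mem_extend _ ?_
  induction stdWord α with
  | nil =>
    rw [word_nil, one_mul, ← mul_one (E.ι a)]
    exact mem_mul_mem_extend ha 1
  | cons i l ih =>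
    rw [word_cons, mul_assoc]
    exact x_mul_mem_extend (hσ i) (hδ i) ih

/-- For a `σ`-invariant ideal `I`, the ideal of all `a ∈ I` with `δ_i(a) ∈ I` for every `i`. -/
def deltaStep (I : TwoSidedIdeal R) (hI : E.IsSigmaInvariant I) : TwoSidedIdeal R :=
  TwoSidedIdeal.mk' {a : R | a ∈ I ∧ ∀ i, E.deltaHom i a ∈ I}
    ⟨I.zero_mem, fun i => by rw [map_zero]; exact I.zero_mem⟩
    (fun {a b} ha hb => ⟨I.add_mem ha.1 hb.1, fun i => by
      rw [map_add]; exact I.add_mem (ha.2 i) (hb.2 i)⟩)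
    (fun {a} ha => ⟨I.neg_mem ha.1, fun i => by rw [map_neg]; exact I.neg_mem (ha.2 i)⟩)
    (fun {r a} ha => ⟨I.mul_mem_left _ _ ha.1, fun i => by
      rw [deltaHom_mul]
      exact I.add_mem (I.mul_mem_left _ _ (ha.2 i)) (I.mul_mem_left _ _ ha.1)⟩)
    (fun {a r} ha => ⟨I.mul_mem_right _ _ ha.1, fun i => by
      rw [deltaHom_mul]
      exact I.add_mem (I.mul_mem_right _ _ (hI i a ha.1)) (I.mul_mem_right _ _ (ha.2 i))⟩)

theorem mem_deltaStep {I : TwoSidedIdeal R} {hI : E.IsSigmaInvariant I} {a : R} :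
    a ∈ deltaStep I hI ↔ a ∈ I ∧ ∀ i, E.deltaHom i a ∈ I := by
  simp only [deltaStep, TwoSidedIdeal.mem_mk', Set.mem_ofPred_eq]

/-- Modulo a `σ`-invariant ideal containing `σ_i(a)`, the maps `δ_j σ_i` and `σ_i δ_j` agree at `a`
up to a unit. -/
theorem deltaHom_sigmaHom_mem_iff (hE : E.IsBijective) (hq : E.IsQuantized) {I : TwoSidedIdeal R}
    (hI : E.IsSigmaInvariant I) (i j : Fin n) {a : R} (ha : E.sigmaHom i a ∈ I) :
    E.deltaHom j (E.sigmaHom i a) ∈ I ↔ E.sigmaHom i (E.deltaHom j a) ∈ I := by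
  obtain ⟨u, t, h⟩ := E.deltaHom_sigmaHom_comm hE hq i j
  have he : t * E.sigmaHom i a - E.sigmaHom j (E.sigmaHom i a) * t ∈ I :=
    I.sub_mem (I.mul_mem_left _ _ ha) (I.mul_mem_right _ _ (hI j _ ha))
  rw [h]
  constructor
  · intro h'
    have := I.mul_mem_left (↑u⁻¹) _ (I.sub_mem h' he)
    rwa [add_sub_cancel_right, Units.inv_mul_cancel_left] at this
  · intro h'
    exact I.add_mem (I.mul_mem_left _ _ h') he

theorem isSigmaInvariant_deltaStep (hE : E.IsBijective) (hq : E.IsQuantized) {I : TwoSidedIdeal R}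
    (hI : E.IsSigmaInvariant I) : E.IsSigmaInvariant (deltaStep I hI) := by
  intro i a ha
  obtain ⟨h1, h2⟩ := mem_deltaStep.1 ha
  refine mem_deltaStep.2 ⟨hI i a h1, fun j => ?_⟩
  exact (deltaHom_sigmaHom_mem_iff hE hq hI i j (hI i a h1)).2 (hI i _ (h2 j))

/-- The `k`-th iterate of `deltaStep`, as an invariant ideal: all `a` which are taken into `I` by
every composite of at most `k` of the maps `δ_i`. -/
def deltaIter (hE : E.IsBijective) (hq : E.IsQuantized) (I : TwoSidedIdeal R)
    (hI : E.IsSigmaInvariant I) : ℕ → {J : TwoSidedIdeal R // E.IsSigmaInvariant J}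
  | 0 => ⟨I, hI⟩
  | k + 1 => ⟨deltaStep _ (deltaIter hE hq I hI k).2,
      isSigmaInvariant_deltaStep hE hq (deltaIter hE hq I hI k).2⟩

section deltaIter

variable (hE : E.IsBijective) (hq : E.IsQuantized) {I : TwoSidedIdeal R}
  (hI : E.IsSigmaInvariant I)

theorem mem_deltaIter_succ {k : ℕ} {a : R} : a ∈ (deltaIter hE hq I hI (k + 1)).1 ↔
    a ∈ (deltaIter hE hq I hI k).1 ∧ ∀ i, E.deltaHom i a ∈ (deltaIter hE hq I hI k).1 :=
  mem_deltaStep (hI := (deltaIter hE hq I hI k).2)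

theorem deltaIter_antitone {k k' : ℕ} (h : k ≤ k') {a : R}
    (ha : a ∈ (deltaIter hE hq I hI k').1) : a ∈ (deltaIter hE hq I hI k).1 := by
  induction h with
  | refl => exact ha
  | step _ ih => exact ih ((mem_deltaIter_succ hE hq hI).1 ha).1

theorem deltaWord_mem_of_mem_deltaIter (l : List (Fin n)) {k : ℕ} {a : R}
    (ha : a ∈ (deltaIter hE hq I hI (k + l.length)).1) :
    E.deltaWord l a ∈ (deltaIter hE hq I hI k).1 := by
  induction l generalizing k with
  | nil => exact ha
  | cons i l ih =>
    rw [List.length_cons, ← add_assoc, add_right_comm] at ha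
    exact ((mem_deltaIter_succ hE hq hI).1 (ih ha)).2 i

theorem word_mul_mem_extend_of_mem_deltaIter (l : List (Fin n)) {k : ℕ} {a : R}
    (ha : a ∈ (deltaIter hE hq I hI (k + l.length)).1) :
    E.word l * E.ι a ∈ E.extend ((deltaIter hE hq I hI k).1 : Set R) := by
  induction l generalizing k with
  | nil =>
    rw [word_nil, one_mul, ← mul_one (E.ι a)]
    exact mem_mul_mem_extend ha 1
  | cons i l ih =>
    rw [List.length_cons, ← add_assoc, add_right_comm] at ha
    rw [word_cons, mul_assoc]
    refine x_mul_mem_extend (fun b hb => ?_) (fun b hb => ?_) (ih ha)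
    · exact (deltaIter hE hq I hI k).2 i b ((mem_deltaIter_succ hE hq hI).1 hb).1
    · exact ((mem_deltaIter_succ hE hq hI).1 hb).2 i

/-- It suffices to test the composites `δ^β`, although the `δ_i` do not commute: `δ^β(δ_i(a))` is
the constant coefficient of `x^β x_i a - x^β σ_i(a) x_i`, and the constant coefficient of
`(x^β x_i) a` is a combination of values `δ^γ(a)`. -/
theorem mem_deltaIter_iff {k : ℕ} {a : R} : a ∈ (deltaIter hE hq I hI k).1 ↔
    ∀ β : Fin n →₀ ℕ, β.degree ≤ k → E.deltaPow β a ∈ I := by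
  constructor
  · intro ha β hβ
    rw [deltaPow_eq]
    refine deltaWord_mem_of_mem_deltaIter hE hq hI (k := 0) (stdWord β) ?_
    refine deltaIter_antitone hE hq hI ?_ ha
    rwa [zero_add, length_stdWord]
  · induction k generalizing a with
    | zero =>
      intro h
      have := h 0 (by simp)
      rwa [deltaPow_eq, List.length_eq_zero_iff.1 ((length_stdWord 0).trans (by simp))] at this
    | succ k ih =>
      intro h
      have hak := ih fun β hβ => h β (hβ.trans k.le_succ)
      refine (mem_deltaIter_succ hE hq hI).2 ⟨hak, fun i => ih fun β hβ => ?_⟩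
      have h1 : E.mon β * E.ι (E.deltaHom i a) =
          E.mon β * E.x i * E.ι a - E.mon β * E.ι (E.sigmaHom i a) * E.x i := by
        rw [mul_assoc, x_mul_hom, mul_add, mul_assoc, add_sub_cancel_left]
      rw [← coeff_mon_mul_ι, h1, map_sub, Finsupp.sub_apply]
      refine I.sub_mem ?_ ?_
      · have hlow : E.mon β * E.x i ∈ E.lowerWords (k + 2) := by
          have := E.ι_mul_word_mem_lowerWords 1 (l := stdWord β ++ [i]) (k := k + 2)
            (by rw [List.length_append, length_stdWord]; simp; omega)
          simpa [word_append, mon_eq_word] using this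
        rw [← E.sum_coeff (E.mon β * E.x i), Finsupp.sum, Finset.sum_mul, map_sum,
          Finsupp.finsetSum_apply]
        refine Finset.sum_induction _ (· ∈ I) (fun _ _ => I.add_mem) I.zero_mem fun γ hγ => ?_
        rw [mul_assoc, coeff_ι_mul, coeff_mon_mul_ι]
        refine I.mul_mem_left _ _ (h γ ?_)
        by_contra hc
        exact (Finsupp.mem_support_iff.1 hγ)
          (E.coeff_eq_zero_of_mem_lowerWords hE hlow (by omega))
      · refine mul_mem_extend (I := I) ?_ _ 0
        rw [mon_eq_word]
        refine word_mul_mem_extend_of_mem_deltaIter hE hq hI (k := 0) (stdWord β) ?_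
        refine deltaIter_antitone hE hq hI ?_ ((deltaIter hE hq I hI k).2 i a hak)
        rwa [zero_add, length_stdWord]

/-- The intersection of the ideals `deltaIter`, i.e. the largest ideal contained in `I` which is
invariant under all `σ_i` and `δ_i`. -/
def deltaCore (hE : E.IsBijective) (hq : E.IsQuantized) (I : TwoSidedIdeal R)
    (hI : E.IsSigmaInvariant I) : TwoSidedIdeal R :=
  TwoSidedIdeal.mk' {a : R | ∀ k, a ∈ (deltaIter hE hq I hI k).1}
    (fun _ => TwoSidedIdeal.zero_mem _) (fun ha hb k => TwoSidedIdeal.add_mem _ (ha k) (hb k))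
    (fun ha k => TwoSidedIdeal.neg_mem _ (ha k))
    (fun ha k => TwoSidedIdeal.mul_mem_left _ _ _ (ha k))
    (fun ha k => TwoSidedIdeal.mul_mem_right _ _ _ (ha k))

theorem mem_deltaCore {a : R} :
    a ∈ deltaCore hE hq I hI ↔ ∀ k, a ∈ (deltaIter hE hq I hI k).1 := by
  simp only [deltaCore, TwoSidedIdeal.mem_mk', Set.mem_ofPred_eq]

theorem mem_deltaCore_iff {a : R} :
    a ∈ deltaCore hE hq I hI ↔ ∀ β : Fin n →₀ ℕ, E.deltaPow β a ∈ I := by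
  simp only [mem_deltaCore, mem_deltaIter_iff]
  exact ⟨fun h β => h _ β le_rfl, fun h _ β _ => h β⟩

theorem isSigmaInvariant_deltaCore : E.IsSigmaInvariant (deltaCore hE hq I hI) := by
  intro i a ha
  rw [mem_deltaCore] at ha ⊢
  exact fun k => (deltaIter hE hq I hI k).2 i a (ha k)

theorem deltaHom_mem_deltaCore (i : Fin n) {a : R} (ha : a ∈ deltaCore hE hq I hI) :
    E.deltaHom i a ∈ deltaCore hE hq I hI := by
  rw [mem_deltaCore] at ha ⊢
  exact fun k => ((mem_deltaIter_succ hE hq hI).1 (ha (k + 1))).2 i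

theorem deltaCore_le {a : R} (ha : a ∈ deltaCore hE hq I hI) : a ∈ I :=
  (mem_deltaCore hE hq hI).1 ha 0

/-- A left ideal of `A` which is contained in `I⟨X⟩` is contained in `J⟨X⟩`, where `J` is the
largest invariant ideal in `I`: if all coefficients of `f` and of `x_i f` lie in an invariant ideal,
then so do the values of `δ_i` at the coefficients of `f`. -/
theorem subset_extend_deltaCore {Q : Set A} (hx : ∀ i, ∀ f ∈ Q, E.x i * f ∈ Q)
    (hQ : Q ⊆ E.extend (I : Set R)) : Q ⊆ E.extend (deltaCore hE hq I hI : Set R) := by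
  have key : ∀ k, Q ⊆ E.extend ((deltaIter hE hq I hI k).1 : Set R) := by
    intro k
    induction k with
    | zero => exact hQ
    | succ k ih =>
      intro f hf α
      refine (mem_deltaIter_succ hE hq hI).2 ⟨ih hf α, fun i => ?_⟩
      -- the part of `x_i f` in which `δ_i` is applied to the coefficients of `f`
      set g : A := E.ofCoeff ((E.coeff f).mapRange (E.deltaHom i) (map_zero _)) with hg
      have hsum : E.x i * f = ((E.coeff f).sum fun γ r => E.ι (E.sigmaHom i r) * (E.x i * E.mon γ))
          + g := by
        rw [hg, ofCoeff_apply, Finsupp.sum_mapRange_index (by simp)]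
        conv_lhs => rw [← E.sum_coeff f]
        rw [Finsupp.sum, Finset.mul_sum, Finsupp.sum, Finsupp.sum, ← Finset.sum_add_distrib]
        refine Finset.sum_congr rfl fun γ _ => ?_
        rw [← mul_assoc, x_mul_hom, add_mul, mul_assoc]
      have hgm : g ∈ E.extend ((deltaIter hE hq I hI k).1 : Set R) := by
        rw [← add_sub_cancel_left
          ((E.coeff f).sum fun γ r => E.ι (E.sigmaHom i r) * (E.x i * E.mon γ)) g, ← hsum]
        refine sub_mem_extend (ih (hx i f hf)) ?_
        exact Finset.sum_induction _ (· ∈ E.extend ((deltaIter hE hq I hI k).1 : Set R))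
          (fun _ _ => add_mem_extend) zero_mem_extend
          fun γ _ => mem_mul_mem_extend ((deltaIter hE hq I hI k).2 i _ (ih hf γ)) _
      have := hgm α
      rwa [hg, coeff, AddEquiv.symm_apply_apply, Finsupp.mapRange_apply] at this
  exact fun f hf α => (mem_deltaCore hE hq hI).2 fun k => key k hf α

/-- Forming the largest invariant ideal commutes with preimages under `σ_i`. -/
theorem mem_deltaCore_comap {I' : TwoSidedIdeal R} (hI' : E.IsSigmaInvariant I') {i : Fin n}
    (h : ∀ a, a ∈ I' ↔ E.sigmaHom i a ∈ I) (a : R) :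
    a ∈ deltaCore hE hq I' hI' ↔ E.sigmaHom i a ∈ deltaCore hE hq I hI := by
  rw [mem_deltaCore, mem_deltaCore]
  refine forall_congr' fun k => ?_
  induction k generalizing a with
  | zero => exact h a
  | succ k ih =>
    rw [mem_deltaIter_succ, mem_deltaIter_succ, ih]
    refine and_congr_right fun ha => forall_congr' fun j => ?_
    rw [ih, deltaHom_sigmaHom_mem_iff hE hq (deltaIter hE hq I hI k).2 i j ha]

end deltaIter

end SkewPBWExtension

namespace SkewPBWExtension

variable {R A : Type*} [Ring R] [Ring A] {n : ℕ} {E : SkewPBWExtension R A n}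
  {M : Type*} [AddCommGroup M] {ord : MonomialOrder (Fin n)}

/-! ### Leading terms in the induced module -/

/-- The elements of `M⟨X⟩` all of whose monomials are smaller than `x^α`. -/
def below (E : SkewPBWExtension R A n) (M : Type*) [AddCommGroup M] (ord : MonomialOrder (Fin n))
    (α : Fin n →₀ ℕ) : AddSubgroup (E.InducedModule M) where
  carrier := {m | ∀ γ, ord.toSyn α ≤ ord.toSyn γ → E.mcoeff m γ = 0}
  zero_mem' γ _ := by rw [map_zero]; rfl
  add_mem' {m m'} hm hm' γ hγ := by
    rw [map_add, Finsupp.add_apply, hm γ hγ, hm' γ hγ, add_zero]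
  neg_mem' {m} hm γ hγ := by rw [map_neg, Finsupp.neg_apply, hm γ hγ, neg_zero]

theorem below_mono {α β : Fin n →₀ ℕ} (h : ord.toSyn α ≤ ord.toSyn β) :
    below E M ord α ≤ below E M ord β := fun _ hm γ hγ => hm γ (h.trans hγ)

theorem term_mem_below {α β : Fin n →₀ ℕ} (h : ord.toSyn α < ord.toSyn β) (v : M) :
    E.term α v ∈ below E M ord β := by
  intro γ hγ
  rw [mcoeff_term, Finsupp.single_eq_of_ne]
  rintro rfl
  exact absurd h hγ.not_gt

theorem sum_term (m : E.InducedModule M) :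
    ∑ γ ∈ (E.mcoeff m).support, E.term γ (E.mcoeff m γ) = m := by
  apply E.mcoeff.injective
  rw [map_sum]
  exact Finsupp.sum_single (E.mcoeff m)

/-- `m = v x^α + (terms in smaller monomials)`; the value `v = 0` is allowed. -/
def HasLead (ord : MonomialOrder (Fin n)) (m : E.InducedModule M) (α : Fin n →₀ ℕ) (v : M) : Prop :=
  m - E.term α v ∈ below E M ord α

theorem HasLead.mcoeff_eq {m : E.InducedModule M} {α : Fin n →₀ ℕ} {v : M}
    (h : HasLead ord m α v) : E.mcoeff m α = v := by
  have := h α le_rfl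
  rwa [map_sub, mcoeff_term, Finsupp.sub_apply, Finsupp.single_eq_same, sub_eq_zero] at this

theorem HasLead.mcoeff_eq_zero {m : E.InducedModule M} {α γ : Fin n →₀ ℕ} {v : M}
    (h : HasLead ord m α v) (hγ : ord.toSyn α < ord.toSyn γ) : E.mcoeff m γ = 0 := by
  have := h γ hγ.le
  rwa [map_sub, mcoeff_term, Finsupp.sub_apply, Finsupp.single_eq_of_ne, sub_zero] at this
  rintro rfl
  exact lt_irrefl _ hγ

theorem HasLead.ne_zero {m : E.InducedModule M} {α : Fin n →₀ ℕ} {v : M}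
    (h : HasLead ord m α v) (hv : v ≠ 0) : m ≠ 0 := by
  rintro rfl
  exact hv (by simpa using h.mcoeff_eq.symm)

theorem HasLead.leadExp_eq {m : E.InducedModule M} {α : Fin n →₀ ℕ} {v : M}
    (h : HasLead ord m α v) (hv : v ≠ 0) : E.leadExp ord m = α := by
  rw [leadExp, AddEquiv.symm_apply_eq]
  refine le_antisymm (Finset.sup_le fun γ hγ => ?_) (Finset.le_sup ?_)
  · by_contra hc
    exact (Finsupp.mem_support_iff.1 hγ) (h.mcoeff_eq_zero (not_le.1 hc))
  · rw [Finsupp.mem_support_iff, h.mcoeff_eq]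
    exact hv

theorem exists_hasLead {m : E.InducedModule M} (hm : m ≠ 0) :
    ∃ v ≠ 0, HasLead ord m (E.leadExp ord m) v := by
  have hne : (E.mcoeff m).support.Nonempty := by
    rw [Finsupp.support_nonempty_iff]
    exact fun h => hm (E.mcoeff.injective (h.trans (map_zero _).symm))
  obtain ⟨α, hα, hmax⟩ := Finset.exists_mem_eq_sup _ hne ord.toSyn
  have hle : E.leadExp ord m = α := by
    rw [leadExp, AddEquiv.symm_apply_eq]; exact hmax
  refine ⟨E.mcoeff m α, Finsupp.mem_support_iff.1 hα, fun γ hγ => ?_⟩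
  rw [hle] at hγ ⊢
  rw [map_sub, mcoeff_term, Finsupp.sub_apply]
  by_cases h : γ = α
  · subst h; rw [Finsupp.single_eq_same, sub_self]
  · rw [Finsupp.single_eq_of_ne h, sub_zero]
    by_contra hc
    have h1 : ord.toSyn γ ≤ ord.toSyn α :=
      hmax ▸ Finset.le_sup (f := ord.toSyn) (Finsupp.mem_support_iff.2 hc)
    exact h (ord.toSyn.injective (le_antisymm h1 hγ))

variable [Module Rᵐᵒᵖ M]

theorem spread_mem_below (hE : E.IsBijective) (hord : ord.IsDegreeCompatible) {α : Fin n →₀ ℕ}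
    {f : A} (hf : f ∈ E.lowerWords α.degree) (v : M) : E.spread v f ∈ below E M ord α := by
  intro γ hγ
  rw [mcoeff_spread, E.coeff_eq_zero_of_mem_lowerWords hE hf, op_zero, zero_smul]
  by_contra hc
  exact absurd (hord _ _ (not_le.1 hc)) hγ.not_gt

/-- If `x^γ b` has leading term `c_γ x^(γ+β)` for every `γ`, then `b` takes `v x^α + ⋯` to
`(v c_α) x^(α+β) + ⋯`. -/
theorem HasLead.smul (hE : E.IsBijective) (hord : ord.IsDegreeCompatible) {β : Fin n →₀ ℕ} {b : A}
    {c : (Fin n →₀ ℕ) → R} (hb : ∀ γ, E.mon γ * b - E.ι (c γ) * E.mon (γ + β) ∈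
      E.lowerWords (γ + β).degree) {m : E.InducedModule M} {α : Fin n →₀ ℕ} {v : M}
    (hm : HasLead ord m α v) : HasLead ord (op b • m) (α + β) (op (c α) • v) := by
  have hterm : ∀ (γ : Fin n →₀ ℕ) (w : M), HasLead ord (op b • E.term γ w) (γ + β) (op (c γ) • w) := by
    intro γ w
    rw [HasLead, op_smul_term, ← spread_mon, ← spread_ι_mul, ← map_sub]
    exact spread_mem_below hE hord (hb γ) w
  have hbelow : ∀ m' ∈ below E M ord α, op b • m' ∈ below E M ord (α + β) := by
    intro m' hm'
    rw [← sum_term m', Finset.smul_sum]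
    refine sum_mem fun γ hγ => ?_
    have hlt : ord.toSyn γ < ord.toSyn α := by
      by_contra hc
      exact (Finsupp.mem_support_iff.1 hγ) (hm' γ (not_lt.1 hc))
    have hlt' : ord.toSyn (γ + β) < ord.toSyn (α + β) := by
      rw [map_add, map_add]; exact add_lt_add_left hlt _
    have := add_mem (below_mono hlt'.le (hterm γ (E.mcoeff m' γ)))
      (term_mem_below hlt' (op (c γ) • E.mcoeff m' γ))
    rwa [sub_add_cancel] at this
  have := add_mem (hbelow _ hm) (hterm α v)
  rwa [smul_sub, sub_add_sub_cancel] at this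

theorem HasLead.smul_ι (hE : E.IsBijective) (hord : ord.IsDegreeCompatible) {α : Fin n →₀ ℕ}
    {m : E.InducedModule M} {v : M} (hm : HasLead ord m α v) (r : R) :
    HasLead ord (op (E.ι r) • m) α (op (E.sigmaWord (stdWord α) r) • v) := by
  have := hm.smul hE hord (β := 0) (b := E.ι r) (c := fun γ => E.sigmaWord (stdWord γ) r)
    (fun γ => by
      rw [add_zero, mon_eq_word, ← length_stdWord]
      exact E.word_mul_ι _ _)
  rwa [add_zero] at this

theorem exists_unit_hasLead_smul (hE : E.IsBijective) (hord : ord.IsDegreeCompatible)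
    (α β : Fin n →₀ ℕ) : ∃ d : Rˣ, ∀ (m : E.InducedModule M) (v : M) (r : R),
      HasLead ord m α v → HasLead ord (op (E.ι r * E.mon β) • m) (α + β)
        (op (E.sigmaWord (stdWord α) r * d) • v) := by
  choose d hd using fun γ => E.exists_unit_mon_mul hE γ β
  exact ⟨d α, fun m v r hm => hm.smul hE hord fun γ => hd γ r⟩

/-! ### Good elements -/

/-- `m` has leading term `v x^α` with `v ≠ 0`, and `m r = 0` as soon as the coefficient
`v σ^α(r)` of `x^α` in `m r` vanishes. -/
structure IsGoodLead (ord : MonomialOrder (Fin n)) (m : E.InducedModule M) (α : Fin n →₀ ℕ)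
    (v : M) : Prop where
  ne_zero : v ≠ 0
  hasLead : HasLead ord m α v
  smul_eq_zero : ∀ r, op (E.sigmaWord (stdWord α) r) • v = 0 → op (E.ι r) • m = 0

theorem IsGoodLead.isGoodPolynomial (hE : E.IsBijective) (hord : ord.IsDegreeCompatible)
    {m : E.InducedModule M} {α : Fin n →₀ ℕ} {v : M} (h : IsGoodLead ord m α v) :
    E.IsGoodPolynomial ord m := by
  refine ⟨h.hasLead.ne_zero h.ne_zero, fun r hr => ?_⟩
  rw [h.hasLead.leadExp_eq h.ne_zero]
  exact (h.hasLead.smul_ι hE hord r).leadExp_eq fun h0 => hr (h.smul_eq_zero r h0)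

theorem exists_isGoodLead (hE : E.IsBijective) (hord : ord.IsDegreeCompatible)
    {m : E.InducedModule M} (h : E.IsGoodPolynomial ord m) :
    ∃ v, IsGoodLead ord m (E.leadExp ord m) v := by
  obtain ⟨v, hv, hm⟩ := exists_hasLead (ord := ord) h.1
  refine ⟨v, hv, hm, fun r hr => ?_⟩
  by_contra hc
  have h1 := hm.smul_ι hE hord r
  rw [hr] at h1
  obtain ⟨w, hw, hw'⟩ := exists_hasLead (ord := ord) hc
  rw [h.2 r hc] at hw'
  exact hw (hw'.mcoeff_eq.symm.trans h1.mcoeff_eq)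

/-- A nonzero `A`-submodule contains good elements: take a nonzero element with the smallest
leading monomial. -/
theorem exists_isGoodPolynomial_mem (hE : E.IsBijective) (hord : ord.IsDegreeCompatible)
    {N : Submodule Aᵐᵒᵖ (E.InducedModule M)} (hN : N ≠ ⊥) :
    ∃ m ∈ N, E.IsGoodPolynomial ord m := by
  obtain ⟨m₀, hm₀, hne₀⟩ := N.exists_mem_ne_zero_of_ne_bot hN
  have hwf : WellFounded fun a b : ord.syn => a < b := wellFounded_lt
  obtain ⟨m, ⟨hm, hne⟩, hmin⟩ := (InvImage.wf (fun m => ord.toSyn (E.leadExp ord m)) hwf).has_min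
    {m : E.InducedModule M | m ∈ N ∧ m ≠ 0} ⟨m₀, hm₀, hne₀⟩
  refine ⟨m, hm, hne, fun r hr => ?_⟩
  obtain ⟨v, hv, hlead⟩ := exists_hasLead (ord := ord) hne
  have h1 := hlead.smul_ι hE hord r
  obtain ⟨w, hw, hw'⟩ := exists_hasLead (ord := ord) hr
  have hle := not_lt.1 (hmin _ ⟨N.smul_mem _ hm, hr⟩)
  rcases hle.lt_or_eq with hlt | heq
  · exact absurd (hw'.mcoeff_eq.symm.trans (h1.mcoeff_eq_zero hlt)) hw
  · exact ord.toSyn.injective heq.symm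

theorem smul_eq_sum (m : E.InducedModule M) (a : A) :
    op a • m = ∑ γ ∈ (E.coeff a).support, op (E.ι (E.coeff a γ) * E.mon γ) • m := by
  rw [← Finset.sum_smul]
  conv_lhs => rw [← E.sum_coeff a]
  rw [Finsupp.sum, Finset.op_sum]

/-- For a good `m` with leading monomial `x^α` and `a = ∑ a_γ x^γ`, no cancellation occurs in the
leading terms of `m a = ∑ (m a_γ) x^γ`: the leading term comes from the largest `γ` with
`m a_γ ≠ 0`. -/
theorem IsGoodLead.exists_hasLead_smul (hE : E.IsBijective) (hord : ord.IsDegreeCompatible)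
    {m : E.InducedModule M} {α : Fin n →₀ ℕ} {v : M} (h : IsGoodLead ord m α v) {a : A}
    {γ : Fin n →₀ ℕ} (ha : op (E.ι (E.coeff a γ)) • m ≠ 0) :
    ∃ (β : Fin n →₀ ℕ) (c : R), op c • v ≠ 0 ∧ HasLead ord (op a • m) (α + β) (op c • v) := by
  classical
  set T := (E.coeff a).support.filter fun γ => op (E.ι (E.coeff a γ)) • m ≠ 0 with hT
  have hγT : γ ∈ T := by
    refine Finset.mem_filter.2 ⟨Finsupp.mem_support_iff.2 fun h0 => ha ?_, ha⟩
    rw [h0, map_zero, op_zero, zero_smul]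
  obtain ⟨β, hβ, hmax⟩ := T.exists_max_image ord.toSyn ⟨γ, hγT⟩
  obtain ⟨hβs, hβm⟩ := Finset.mem_filter.1 hβ
  obtain ⟨d, hd⟩ := exists_unit_hasLead_smul (M := M) hE hord α β
  refine ⟨β, E.sigmaWord (stdWord α) (E.coeff a β) * d, fun h0 => hβm (h.smul_eq_zero _ ?_), ?_⟩
  · have := congrArg (fun w => op (↑d⁻¹ : R) • w) h0
    simpa only [smul_zero, ← mul_smul, ← op_mul, Units.mul_inv_cancel_right] using this
  · rw [smul_eq_sum, ← Finset.add_sum_erase _ _ hβs, HasLead, add_sub_right_comm]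
    refine add_mem (hd m v _ h.hasLead) (sum_mem fun δ hδ => ?_)
    obtain ⟨hδβ, hδs⟩ := Finset.mem_erase.1 hδ
    by_cases hδm : op (E.ι (E.coeff a δ)) • m = 0
    · rw [op_mul, mul_smul, hδm, smul_zero]
      exact zero_mem _
    · have hlt : ord.toSyn (α + δ) < ord.toSyn (α + β) := by
        rw [map_add, map_add]
        refine add_lt_add_right (lt_of_le_of_ne (hmax δ (Finset.mem_filter.2 ⟨hδs, hδm⟩)) ?_) _
        exact fun h => hδβ (ord.toSyn.injective h)
      obtain ⟨d', hd'⟩ := exists_unit_hasLead_smul (M := M) hE hord α δ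
      have := add_mem (below_mono hlt.le (hd' m v (E.coeff a δ) h.hasLead))
        (term_mem_below hlt (op (E.sigmaWord (stdWord α) (E.coeff a δ) * (d' : R)) • v))
      rwa [sub_add_cancel] at this

/-- An element which kills a good `m` kills it coefficient by coefficient. -/
theorem IsGoodLead.smul_coeff_eq_zero (hE : E.IsBijective) (hord : ord.IsDegreeCompatible)
    {m : E.InducedModule M} {α : Fin n →₀ ℕ} {v : M} (h : IsGoodLead ord m α v) {a : A}
    (ha : op a • m = 0) (γ : Fin n →₀ ℕ) : op (E.ι (E.coeff a γ)) • m = 0 := by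
  by_contra hc
  obtain ⟨β, c, hc', hl⟩ := h.exists_hasLead_smul hE hord hc
  exact hl.ne_zero hc' ha

/-- The nonzero multiples of a good `m` with leading coefficient `v` have leading coefficients
in `v R`, and their leading monomials are multiples of the one of `m`. -/
theorem IsGoodLead.exists_hasLead_of_smul_ne_zero (hE : E.IsBijective)
    (hord : ord.IsDegreeCompatible) {m : E.InducedModule M} {α : Fin n →₀ ℕ} {v : M}
    (h : IsGoodLead ord m α v) {a : A} (ha : op a • m ≠ 0) :
    ∃ (β : Fin n →₀ ℕ) (c : R), op c • v ≠ 0 ∧ HasLead ord (op a • m) (α + β) (op c • v) := by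
  have : ∃ γ, op (E.ι (E.coeff a γ)) • m ≠ 0 := by
    by_contra! hc
    refine ha ?_
    rw [smul_eq_sum]
    refine Finset.sum_eq_zero fun γ _ => ?_
    rw [op_mul, mul_smul, hc, smul_zero]
  obtain ⟨γ, hγ⟩ := this
  exact h.exists_hasLead_smul hE hord hγ

end SkewPBWExtension

/-! ### Prime submodules -/

namespace RightModule

variable {R M : Type*} [Ring R] [AddCommGroup M] [Module Rᵐᵒᵖ M]

theorem IsPrimeSubmodule.annihilator_span_singleton {N : Submodule Rᵐᵒᵖ M}
    (hN : IsPrimeSubmodule N) {v : M} (hv : v ∈ N) (hv0 : v ≠ 0) :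
    annihilator N = annihilator (Submodule.span Rᵐᵒᵖ {v}) :=
  hN.2 _ ((Submodule.span_singleton_le_iff_mem _ _).2 hv) (by simpa using hv0)

theorem mem_annihilator_span_singleton {v : M} {a : R} :
    a ∈ annihilator (Submodule.span Rᵐᵒᵖ {v}) ↔ ∀ r : R, op (r * a) • v = 0 := by
  rw [mem_annihilator]
  constructor
  · intro h r
    rw [op_mul, mul_smul]
    exact h _ (Submodule.smul_mem _ _ (Submodule.mem_span_singleton_self v))
  · intro h w hw
    obtain ⟨c, rfl⟩ := Submodule.mem_span_singleton.1 hw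
    rw [← mul_smul]
    exact h c.unop

theorem IsPrimeSubmodule.mem_annihilator_iff {N : Submodule Rᵐᵒᵖ M}
    (hN : IsPrimeSubmodule N) {v : M} (hv : v ∈ N) (hv0 : v ≠ 0) {a : R} :
    a ∈ annihilator N ↔ ∀ r : R, op (r * a) • v = 0 := by
  rw [hN.annihilator_span_singleton hv hv0, mem_annihilator_span_singleton]

/-- The annihilator of a prime submodule is a prime ideal. -/
theorem IsPrimeSubmodule.isPrimeIdeal {N : Submodule Rᵐᵒᵖ M} (hN : IsPrimeSubmodule N) :
    IsPrimeIdeal (annihilator N) := by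
  obtain ⟨v, hv, hv0⟩ := N.exists_mem_ne_zero_of_ne_bot hN.1
  refine ⟨fun h => hv0 ?_, fun a b hab => or_iff_not_imp_left.2 fun ha => ?_⟩
  · have h1 : (1 : R) ∈ annihilator N := by rw [h]; trivial
    simpa using (mem_annihilator N 1).1 h1 v hv
  · rw [mem_annihilator] at ha
    push Not at ha
    obtain ⟨w, hw, hwa⟩ := ha
    refine (hN.mem_annihilator_iff (N.smul_mem (op a) hw) hwa).2 fun r => ?_
    rw [← mul_smul, ← op_mul, ← mul_assoc]
    exact (mem_annihilator N _).1 (hab r) w hw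

theorem IsPrimeSubmodule.annihilator_mem_ass {N : Submodule Rᵐᵒᵖ M} (hN : IsPrimeSubmodule N) :
    annihilator N ∈ Ass R M := ⟨hN.isPrimeIdeal, N, hN, rfl⟩

end RightModule

namespace SkewPBWExtension

open RightModule

variable {R A : Type*} [Ring R] [Ring A] {n : ℕ} {E : SkewPBWExtension R A n}
  {M : Type*} [AddCommGroup M] [Module Rᵐᵒᵖ M] {ord : MonomialOrder (Fin n)}

/-! ### Annihilators of good elements -/

/-- Every nonzero submodule of `M⟨X⟩` contains a good element whose leading coefficient lies in a
prime submodule of `M`: multiply a good element by a suitable element of `R`. -/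
theorem exists_isGoodLead_mem_isPrimeSubmodule (hE : E.IsBijective)
    (hord : ord.IsDegreeCompatible) (hM : HasEnoughPrimeSubmodules R M)
    {N : Submodule Aᵐᵒᵖ (E.InducedModule M)} (hN : N ≠ ⊥) :
    ∃ m ∈ N, ∃ (α : Fin n →₀ ℕ) (v : M) (N' : Submodule Rᵐᵒᵖ M),
      IsPrimeSubmodule N' ∧ v ∈ N' ∧ IsGoodLead ord m α v := by
  obtain ⟨m, hm, hgood⟩ := exists_isGoodPolynomial_mem hE hord hN
  obtain ⟨v, hv⟩ := exists_isGoodLead hE hord hgood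
  obtain ⟨N', hle, hN'⟩ := hM (Submodule.span Rᵐᵒᵖ {v}) (by simpa using hv.ne_zero)
  obtain ⟨w, hw, hw0⟩ := N'.exists_mem_ne_zero_of_ne_bot hN'.1
  obtain ⟨c, rfl⟩ := Submodule.mem_span_singleton.1 (hle hw)
  obtain ⟨s, hs⟩ := E.sigmaWord_surjective hE (stdWord (E.leadExp ord m)) c.unop
  have hc : op (E.sigmaWord (stdWord (E.leadExp ord m)) s) = c := by rw [hs, op_unop]
  refine ⟨op (E.ι s) • m, N.smul_mem _ hm, E.leadExp ord m, c • v, N', hN', hw, hw0, ?_,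
    fun r hr => ?_⟩
  · rw [← hc]
    exact hv.hasLead.smul_ι hE hord s
  · rw [← hc, ← mul_smul, ← op_mul, ← map_mul] at hr
    rw [← mul_smul, ← op_mul, ← map_mul]
    exact hv.smul_eq_zero _ hr

variable {N : Submodule Rᵐᵒᵖ M} {m : E.InducedModule M} {α : Fin n →₀ ℕ} {v : M}

/-- The annihilator of `m R` in `R`, for a good `m`, is the preimage under `σ^α` of an associated
prime of `M`. -/
theorem IsGoodLead.forall_smul_eq_zero_iff (hE : E.IsBijective) (hord : ord.IsDegreeCompatible)
    (h : IsGoodLead ord m α v) (hN : IsPrimeSubmodule N) (hv : v ∈ N) {a : R} :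
    (∀ r, op (E.ι (r * a)) • m = 0) ↔ E.sigmaWord (stdWord α) a ∈ annihilator N := by
  rw [hN.mem_annihilator_iff hv h.ne_zero]
  constructor
  · intro h0 r
    obtain ⟨s, rfl⟩ := E.sigmaWord_surjective hE (stdWord α) r
    have h1 := h.hasLead.smul_ι hE hord (s * a)
    rw [h0 s, map_mul] at h1
    simpa using h1.mcoeff_eq.symm
  · intro h0 r
    refine h.smul_eq_zero _ ?_
    rw [map_mul]
    exact h0 _

theorem IsGoodLead.sigmaWord_coeff_mem (hE : E.IsBijective) (hord : ord.IsDegreeCompatible)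
    (h : IsGoodLead ord m α v) (hN : IsPrimeSubmodule N) (hv : v ∈ N) {f : A}
    (hf : f ∈ annihilator (Submodule.span Aᵐᵒᵖ {m})) (γ : Fin n →₀ ℕ) :
    E.sigmaWord (stdWord α) (E.coeff f γ) ∈ annihilator N := by
  rw [← h.forall_smul_eq_zero_iff hE hord hN hv]
  intro r
  rw [← coeff_ι_mul]
  exact h.smul_coeff_eq_zero hE hord (mem_annihilator_span_singleton.1 hf _) γ

/-- An ideal `J` invariant under all `σ_i` and `δ_i` satisfies `A J ⊆ J A`, so `m R J = 0` implies
`m A J A = 0`. -/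
theorem IsGoodLead.extend_subset_annihilator (hE : E.IsBijective) (hord : ord.IsDegreeCompatible)
    (h : IsGoodLead ord m α v) (hN : IsPrimeSubmodule N) (hv : v ∈ N) {J : TwoSidedIdeal R}
    (hσ : E.IsSigmaInvariant J) (hδ : ∀ i, ∀ a ∈ J, E.deltaHom i a ∈ J)
    (hJ : ∀ a ∈ J, E.sigmaWord (stdWord α) a ∈ annihilator N) :
    E.extend (J : Set R) ⊆ (annihilator (Submodule.span Aᵐᵒᵖ {m}) : Set A) := by
  have hkill : ∀ f ∈ E.extend (J : Set R), op f • m = 0 := fun f hf =>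
    extend_induction (p := fun f => op f • m = 0) (by simp)
      (fun f g hf hg => by rw [op_add, add_smul, hf, hg, add_zero])
      (fun r hr β => by
        have h1 := (h.forall_smul_eq_zero_iff hE hord hN hv).2 (hJ r hr) 1
        rw [one_mul] at h1
        rw [op_mul, mul_smul, h1, smul_zero]) hf
  intro f hf
  refine mem_annihilator_span_singleton.2 fun g => hkill _ ?_
  exact extend_induction (p := fun f => g * f ∈ E.extend (J : Set R))
    (by rw [mul_zero]; exact zero_mem_extend)
    (fun f f' hf hf' => by rw [mul_add]; exact add_mem_extend hf hf')
    (fun r hr β => by rw [← mul_assoc]; exact mul_mem_extend (mul_ι_mem_extend hσ hδ g hr) _) hf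

/-! ### Stable associated primes -/

theorem mem_iff_sigmaWord_mem {P : TwoSidedIdeal R} (hE : E.IsBijective)
    (hP : ∀ i, E.sigma i '' (P : Set R) = P) (l : List (Fin n)) (a : R) :
    E.sigmaWord l a ∈ P ↔ a ∈ P := by
  induction l with
  | nil => rfl
  | cons i l ih =>
    rw [sigmaWord_cons, ← ih, sigmaHom_apply]
    constructor
    · intro h
      have h' : E.sigma i (E.sigmaWord l a) ∈ E.sigma i '' (P : Set R) := by rw [hP i]; exact h
      obtain ⟨b, hb, hbe⟩ := h'
      rwa [(hE.1 i).1 hbe] at hb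
    · intro h
      have : E.sigma i (E.sigmaWord l a) ∈ E.sigma i '' (P : Set R) := ⟨_, h, rfl⟩
      rwa [hP i] at this

theorem isSigmaInvariant_of_image_eq {P : TwoSidedIdeal R}
    (hP : ∀ i, E.sigma i '' (P : Set R) = P) : E.IsSigmaInvariant P := fun i a ha => by
  have : E.sigma i a ∈ E.sigma i '' (P : Set R) := ⟨a, ha, rfl⟩
  rwa [hP i] at this

theorem coe_deltaCore (hE : E.IsBijective) (hq : E.IsQuantized) {P : TwoSidedIdeal R}
    (hP : E.IsSigmaInvariant P) :
    (deltaCore hE hq P hP : Set R) = E.deltaPart (P : Set R) := by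
  ext a
  exact ⟨fun ha => ⟨deltaCore_le hE hq hP ha, (mem_deltaCore_iff hE hq hP).1 ha⟩,
    fun ha => (mem_deltaCore_iff hE hq hP).2 ha.2⟩

/-! ### Orbits of an ideal under the `σ_i` -/

/-- For a two-sided ideal `P`, the ideal of all `a` with `σ^(λ + γ)(a) ∈ P` for all `γ`. -/
def sigmaCore (E : SkewPBWExtension R A n) (P : TwoSidedIdeal R) (lam : Fin n →₀ ℕ) :
    TwoSidedIdeal R :=
  TwoSidedIdeal.mk' {a : R | ∀ γ, E.sigmaWord (stdWord (lam + γ)) a ∈ P}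
    (fun γ => by rw [map_zero]; exact P.zero_mem)
    (fun ha hb γ => by rw [map_add]; exact P.add_mem (ha γ) (hb γ))
    (fun ha γ => by rw [map_neg]; exact P.neg_mem (ha γ))
    (fun ha γ => by rw [map_mul]; exact P.mul_mem_left _ _ (ha γ))
    (fun ha γ => by rw [map_mul]; exact P.mul_mem_right _ _ (ha γ))

theorem mem_sigmaCore {P : TwoSidedIdeal R} {lam : Fin n →₀ ℕ} {a : R} :
    a ∈ sigmaCore E P lam ↔ ∀ γ, E.sigmaWord (stdWord (lam + γ)) a ∈ P := by
  simp only [sigmaCore, TwoSidedIdeal.mem_mk', Set.mem_ofPred_eq]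

theorem sigmaWord_sigmaHom_mem_iff (hE : E.IsBijective) (P : TwoSidedIdeal R) (lam : Fin n →₀ ℕ)
    (i : Fin n) (a : R) : E.sigmaWord (stdWord lam) (E.sigmaHom i a) ∈ P ↔
      E.sigmaWord (stdWord (lam + Finsupp.single i 1)) a ∈ P := by
  have h : (stdWord lam ++ [i]).Perm (stdWord (lam + Finsupp.single i 1)) := by
    rw [List.perm_iff_count]
    intro j
    simp [count_stdWord, List.count_singleton, Finsupp.single_apply]
  rw [← E.sigmaWord_mem_iff_of_perm hE h, sigmaWord_append, sigmaWord_cons, sigmaWord_nil]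

theorem mem_sigmaCore_add_single (hE : E.IsBijective) (P : TwoSidedIdeal R) (lam : Fin n →₀ ℕ)
    (i : Fin n) (a : R) :
    a ∈ sigmaCore E P (lam + Finsupp.single i 1) ↔ E.sigmaHom i a ∈ sigmaCore E P lam := by
  rw [mem_sigmaCore, mem_sigmaCore]
  refine forall_congr' fun γ => ?_
  rw [sigmaWord_sigmaHom_mem_iff hE, add_right_comm]

theorem isSigmaInvariant_sigmaCore (hE : E.IsBijective) (P : TwoSidedIdeal R)
    (lam : Fin n →₀ ℕ) : E.IsSigmaInvariant (sigmaCore E P lam) := by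
  intro i a ha
  rw [mem_sigmaCore] at ha ⊢
  intro γ
  rw [sigmaWord_sigmaHom_mem_iff hE, add_assoc]
  exact ha _

/-- The largest ideal in `sigmaCore E P λ` invariant under all `σ_i` and `δ_i`. -/
def sigmaDeltaCore (hE : E.IsBijective) (hq : E.IsQuantized) (P : TwoSidedIdeal R)
    (lam : Fin n →₀ ℕ) : TwoSidedIdeal R :=
  deltaCore hE hq (sigmaCore E P lam) (isSigmaInvariant_sigmaCore hE P lam)

/-- Raising the exponent by `e_i` is taking the preimage under `σ_i`. -/
theorem mem_sigmaDeltaCore_add_single (hE : E.IsBijective) (hq : E.IsQuantized)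
    (P : TwoSidedIdeal R) (lam : Fin n →₀ ℕ) (i : Fin n) (a : R) :
    a ∈ sigmaDeltaCore hE hq P (lam + Finsupp.single i 1) ↔
      E.sigmaHom i a ∈ sigmaDeltaCore hE hq P lam :=
  mem_deltaCore_comap hE hq _ _ (mem_sigmaCore_add_single hE P lam i) a

theorem sigmaDeltaCore_cancel (hE : E.IsBijective) (hq : E.IsQuantized) (P : TwoSidedIdeal R)
    {lam mu nu : Fin n →₀ ℕ}
    (h : sigmaDeltaCore hE hq P (lam + nu) = sigmaDeltaCore hE hq P (mu + nu)) :
    sigmaDeltaCore hE hq P lam = sigmaDeltaCore hE hq P mu := by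
  rw [← expOf_stdWord nu] at h
  generalize stdWord nu = l at h
  induction l with
  | nil => simpa [expOf] using h
  | cons i l ih =>
    refine ih (TwoSidedIdeal.ext fun a => ?_)
    rw [expOf_cons, ← add_assoc, ← add_assoc] at h
    obtain ⟨b, rfl⟩ := E.sigmaHom_surjective hE i a
    rw [← mem_sigmaDeltaCore_add_single, ← mem_sigmaDeltaCore_add_single, h]

theorem coe_sigmaDeltaCore_zero (hE : E.IsBijective) (hq : E.IsQuantized) (P : TwoSidedIdeal R) :
    (sigmaDeltaCore hE hq P 0 : Set R) = E.sigmaDeltaPart (P : Set R) := by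
  ext a
  have h : a ∈ sigmaDeltaCore hE hq P 0 ↔
      ∀ α β, E.sigmaPow α (E.deltaPow β a) ∈ (P : Set R) := by
    rw [sigmaDeltaCore, mem_deltaCore_iff, forall_comm]
    refine forall_congr' fun β => mem_sigmaCore.trans (forall_congr' fun γ => ?_)
    rw [zero_add, sigmaPow_eq]
    rfl
  have h0 : stdWord (0 : Fin n →₀ ℕ) = [] :=
    List.length_eq_zero_iff.1 ((length_stdWord 0).trans (by simp))
  refine h.trans ⟨fun ha => ⟨?_, ha⟩, fun ha => ha.2⟩
  have := ha 0 0
  rwa [sigmaPow_eq, deltaPow_eq, h0] at this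

/-- If `M⟨X⟩` is good, then the annihilator of `m A` can be computed from good elements of `m A`
with arbitrarily large leading monomials, whose leading coefficients stay in the same prime
submodule of `M`. -/
theorem IsGoodLead.annihilator_eq_extend_sigmaDeltaCore (hE : E.IsBijective)
    (hord : ord.IsDegreeCompatible) (hq : E.IsQuantized) (hgood : E.IsGoodModule M ord)
    (h : IsGoodLead ord m α v) (hN : IsPrimeSubmodule N) (hv : v ∈ N)
    (hprime : ∀ f ∈ Submodule.span Aᵐᵒᵖ {m}, f ≠ 0 →
      annihilator (Submodule.span Aᵐᵒᵖ {f}) = annihilator (Submodule.span Aᵐᵒᵖ {m}))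
    (β : Fin n →₀ ℕ) :
    (annihilator (Submodule.span Aᵐᵒᵖ {m}) : Set A) =
      E.extend (sigmaDeltaCore hE hq (annihilator N) (α + β) : Set R) := by
  have key : ∀ γ : Fin n →₀ ℕ, ∃ (f : E.InducedModule M) (w : M),
      f ∈ Submodule.span Aᵐᵒᵖ {m} ∧ w ∈ N ∧ IsGoodLead ord f (α + γ) w := by
    intro γ
    obtain ⟨f, hf, hfg, hfl⟩ := hgood m (h.isGoodPolynomial hE hord) (α + γ) (by
      rw [h.hasLead.leadExp_eq h.ne_zero]; exact le_self_add)
    obtain ⟨w, hw⟩ := exists_isGoodLead hE hord hfg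
    rw [hfl] at hw
    refine ⟨f, w, hf, ?_, hw⟩
    obtain ⟨a, rfl⟩ := Submodule.mem_span_singleton.1 hf
    obtain ⟨δ, c, hc, hl⟩ := h.exists_hasLead_of_smul_ne_zero hE hord (a := a.unop)
      (by rw [op_unop]; exact hfg.1)
    rw [op_unop] at hl
    have he : α + δ = α + γ := by rw [← hl.leadExp_eq hc, hfl]
    rw [he] at hl
    rw [← hw.hasLead.mcoeff_eq, hl.mcoeff_eq]
    exact N.smul_mem _ hv
  apply Set.Subset.antisymm
  · refine subset_extend_deltaCore hE hq _
      (fun i f hf => TwoSidedIdeal.mul_mem_left _ _ _ hf) fun g hg γ => ?_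
    refine mem_sigmaCore.2 fun δ => ?_
    obtain ⟨f, w, hf, hw, hfw⟩ := key (β + δ)
    rw [add_assoc]
    refine hfw.sigmaWord_coeff_mem hE hord hN hw ?_ γ
    rw [hprime f hf (hfw.hasLead.ne_zero hfw.ne_zero)]
    exact hg
  · obtain ⟨f, w, hf, hw, hfw⟩ := key β
    rw [← hprime f hf (hfw.hasLead.ne_zero hfw.ne_zero)]
    refine hfw.extend_subset_annihilator hE hord hN hw (isSigmaInvariant_deltaCore hE hq _)
      (fun i a => deltaHom_mem_deltaCore hE hq _ i) fun a ha => ?_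
    have := mem_sigmaCore.1 (deltaCore_le hE hq _ ha) 0
    rwa [add_zero] at this

/-! ### Associated primes of the induced module -/

theorem isDegreeCompatible_degLex : (MonomialOrder.degLex (σ := Fin n)).IsDegreeCompatible :=
  fun _ _ h => MonomialOrder.degLex_lt_iff.2 (Finsupp.DegLex.lt_iff.2 (Or.inl h))

end SkewPBWExtension

end

open SkewPBWExtension RightModule

theorem theorem5p7 {R A M : Type*} [Ring R] [Ring A] [AddCommGroup M] [Module Rᵐᵒᵖ M] {n : ℕ}
    (E : SkewPBWExtension R A n) (hE : E.IsBijective)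
    (hM : RightModule.HasEnoughPrimeSubmodules R M)
    (Q : TwoSidedIdeal A) (hQ : Q ∈ RightModule.Ass A (E.InducedModule M)) :
    ((∀ P ∈ RightModule.Ass R M, E.IsSigmaDeltaStable (P : Set R)) →
      ∃ P ∈ RightModule.Ass R M, (Q : Set A) = E.extend (P : Set R)) ∧
    (E.IsQuantized → (∀ P ∈ RightModule.Ass R M, E.IsSigmaStable (P : Set R)) →
      ∃ P ∈ RightModule.Ass R M, (Q : Set A) = E.extend (E.deltaPart (P : Set R))) ∧
    (∀ ord : MonomialOrder (Fin n), ord.IsDegreeCompatible →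
      E.IsQuantized → E.IsGoodModule M ord →
      ∃ P ∈ RightModule.Ass R M,
        (Q : Set A) = E.extend (E.sigmaDeltaPart (P : Set R)) ∧
        E.IsSigmaStable (E.sigmaDeltaPart (P : Set R))) := by
  obtain ⟨-, N₀, hN₀, rfl⟩ := hQ
  refine ⟨fun hP => ?_, fun hq hP => ?_, fun ord hord hq hgood => ?_⟩
  · obtain ⟨m, hm, α, v, N, hN, hv, h⟩ := exists_isGoodLead_mem_isPrimeSubmodule hE
      isDegreeCompatible_degLex hM hN₀.1
    have hPσ := fun i => (hP _ hN.annihilator_mem_ass i).1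
    refine ⟨annihilator N, hN.annihilator_mem_ass, ?_⟩
    rw [hN₀.annihilator_span_singleton hm (h.hasLead.ne_zero h.ne_zero)]
    apply Set.Subset.antisymm
    · intro f hf γ
      exact (mem_iff_sigmaWord_mem hE hPσ _ _).1
        (h.sigmaWord_coeff_mem hE isDegreeCompatible_degLex hN hv hf γ)
    · exact h.extend_subset_annihilator hE isDegreeCompatible_degLex hN hv
        (isSigmaInvariant_of_image_eq hPσ)
        (fun i a ha => (hP _ hN.annihilator_mem_ass i).2 ⟨a, ha, rfl⟩)
        (fun a ha => (mem_iff_sigmaWord_mem hE hPσ _ _).2 ha)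
  · obtain ⟨m, hm, α, v, N, hN, hv, h⟩ := exists_isGoodLead_mem_isPrimeSubmodule hE
      isDegreeCompatible_degLex hM hN₀.1
    have hPσ := hP _ hN.annihilator_mem_ass
    have hI := isSigmaInvariant_of_image_eq hPσ
    refine ⟨annihilator N, hN.annihilator_mem_ass, ?_⟩
    rw [hN₀.annihilator_span_singleton hm (h.hasLead.ne_zero h.ne_zero), ← coe_deltaCore hE hq hI]
    apply Set.Subset.antisymm
    · refine subset_extend_deltaCore hE hq hI
        (fun i f hf => TwoSidedIdeal.mul_mem_left _ _ _ hf) fun f hf γ => ?_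
      exact (mem_iff_sigmaWord_mem hE hPσ _ _).1
        (h.sigmaWord_coeff_mem hE isDegreeCompatible_degLex hN hv hf γ)
    · exact h.extend_subset_annihilator hE isDegreeCompatible_degLex hN hv
        (isSigmaInvariant_deltaCore hE hq hI) (fun i a => deltaHom_mem_deltaCore hE hq hI i)
        (fun a ha => (mem_iff_sigmaWord_mem hE hPσ _ _).2 (deltaCore_le hE hq hI ha))
  · obtain ⟨m, hm, α, v, N, hN, hv, h⟩ := exists_isGoodLead_mem_isPrimeSubmodule hE hord hM hN₀.1
    have hm0 := h.hasLead.ne_zero h.ne_zero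
    have heq := h.annihilator_eq_extend_sigmaDeltaCore hE hord hq hgood hN hv fun f hf hf0 => by
      rw [← hN₀.annihilator_span_singleton hm hm0, ← hN₀.annihilator_span_singleton
        ((Submodule.span_singleton_le_iff_mem _ _).2 hm hf) hf0]
    set J := sigmaDeltaCore hE hq (annihilator N) with hJ
    -- the ideals `J (α + β)` all have the same extension, hence coincide
    have hconst : ∀ β, J (0 + α) = J (β + α) := fun β => by
      have := extend_injective ((heq 0).symm.trans (heq β)) (TwoSidedIdeal.zero_mem _)
        (TwoSidedIdeal.zero_mem _)
      rw [zero_add, add_comm β α]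
      rw [add_zero] at this
      exact SetLike.coe_injective this
    have hJ0 : ∀ β, J 0 = J β := fun β => sigmaDeltaCore_cancel hE hq _ (hconst β)
    refine ⟨annihilator N, hN.annihilator_mem_ass, ?_⟩
    rw [← coe_sigmaDeltaCore_zero hE hq, hN₀.annihilator_span_singleton hm hm0]
    constructor
    · rw [heq 0, ← hJ, ← hJ0]
    · intro i
      have hi : ∀ a, a ∈ J 0 ↔ E.sigmaHom i a ∈ J 0 := fun a => by
        have := mem_sigmaDeltaCore_add_single hE hq (annihilator N) 0 i a
        rwa [← hJ, ← hJ0] at this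
      ext b
      constructor
      · rintro ⟨a, ha, rfl⟩
        exact (hi a).1 ha
      · intro hb
        obtain ⟨a, rfl⟩ := E.sigmaHom_surjective hE i b
        exact ⟨a, (hi a).2 hb, rfl⟩
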